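/- Throughout, $\mathbb{R}^d=\mathbb{R}^{d-1}\times\mathbb{R}$ carries the Euclidean norm $\|\cdot\|$, $\mathbb{N}=\{1,2,\dots\}$, and for $M\ge 1$ a mapping $g\colon A\to\mathbb{R}^d$, $A\subseteq\mathbb{R}^d$, is called $M$-bilipschitz if $\frac1M\|x-y\|\le\|g(x)-g(y)\|\le M\|x-y\|$ for all $x,y\in A$. For $d\ge 2$ let $\mathcal{F}_d$ be the collection of all monotone increasing functions $\psi\colon[1,\infty)\to[1,\infty)$ with the following property: given any $S\in\mathbb{N}$, $Q:=(-\frac12,\dots,-\frac12)+[0,S]^{d-1}$, and any permutation $\sigma$ of $\mathbb{Z}^{d-1}$ that restricts to a permutation of $\mathbb{Z}^{d-1}\cap(Q+Sz)$ for each $z\in\mathbb{Z}^{d-1}$, there is a $\psi(S)$-bilipschitz mapping $\Upsilon\colon\mathbb{R}^d\to\mathbb{R}^d$ such that $\Upsilon(x)=x$ for all $x\in\mathbb{R}^{d-1}\times\bigl(\mathbb{R}\setminus(-\frac12,\frac12)\bigr)$ and $\Upsilon(x,0)=(\sigma(x),0)$ for all $x\in\mathbb{Z}^{d-1}$. Theorem.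 Let $d\in\mathbb{N}$ with $d\ge2$. Then there is a monotone increasing function $\beta_d\colon[1,\infty)\to[1,\infty)$ with $$2\lfloor t\rfloor-1\le\beta_d(t)\le 2^{8dt}\qquad\text{for all }t\in[1,\infty)$$ such that the following statement holds. For any $H\in\mathbb{N}$, any $L\ge1$ and any $L$-bilipschitz mapping $$f\colon\bigl(\mathbb{R}^{d-1}\times\{\tfrac12,H+\tfrac12\}\bigr)\cup\bigl(\mathbb{Z}^{d-1}\times\{1,\dots,H\}\bigr)\to\mathbb{R}^d$$ satisfying $f(x)=x$ for all $x\in\mathbb{R}^{d-1}\times\{\frac12,H+\frac12\}$ and $f(\mathbb{Z}^{d-1}\times\{1,\dots,H\})\subseteq\mathbb{R}^{d-1}\times[\frac12,H+\frac12]$, there is an extension $F\colon\mathbb{R}^d\to\mathbb{R}^d$ of $f$ that is $C$-bilipschitz with $$C=2^{38}d^{9/2}L^{9}H^{2+\frac{3}{d-1}}\cdot\beta_d\Bigl(2^{42}d^{9/2}L^{10}H^{3+\frac{3}{d-1}}\Bigr)^{3^{d-1}}.$$ Moreover, $\beta_d$ may be taken to be the pointwise infimum of $\mathcal{F}_d$,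 i.e. $\beta_d(t)=\inf_{\psi\in\mathcal{F}_d}\psi(t)$ for all $t\in[1,\infty)$. -/

import Mathlib

/-- The point `(x, h)` of `ℝ^d = ℝ^{d-1} × ℝ`: its first `d - 1` coordinates are those of `x`
and its last coordinate is `h`.  (Used for `d ≥ 2`.) -/
noncomputable def layerPoint (d : ℕ) (x : Fin (d - 1) → ℝ) (h : ℝ) : EuclideanSpace ℝ (Fin d) :=
  WithLp.toLp 2 (fun i => if hi : (i : ℕ) < d - 1 then x ⟨i, hi⟩ else h)

/-- The set `ℝ^{d-1} × T` in `ℝ^d`. -/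
def cylinderOver (d : ℕ) (T : Set ℝ) : Set (EuclideanSpace ℝ (Fin d)) :=
  {p | ∃ x : Fin (d - 1) → ℝ, ∃ h ∈ T, p = layerPoint d x h}

/-- The point `(z, h)` with `z ∈ ℤ^{d-1}` and `h ∈ ℝ`. -/
noncomputable def latticePoint (d : ℕ) (z : Fin (d - 1) → ℤ) (h : ℝ) :
    EuclideanSpace ℝ (Fin d) :=
  layerPoint d (fun i => (z i : ℝ)) h

/-- The lattice layers `ℤ^{d-1} × {1, …, H}` in `ℝ^d`. -/
def latticeLayers (d H : ℕ) : Set (EuclideanSpace ℝ (Fin d)) :=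
  {p | ∃ z : Fin (d - 1) → ℤ, ∃ m : ℕ, 1 ≤ m ∧ m ≤ H ∧ p = latticePoint d z (m : ℝ)}

/-- `f` restricted to `A` is `L`-bilipschitz: both `f|_A` and its inverse `f(A) → A` are
`L`-Lipschitz.  (The second inequality makes `f` injective on `A`.) -/
def IsBilipOn {E F : Type*} [MetricSpace E] [MetricSpace F] (L : ℝ) (f : E → F) (A : Set E) :
    Prop :=
  ∀ x ∈ A, ∀ y ∈ A, dist (f x) (f y) ≤ L * dist x y ∧ dist x y ≤ L * dist (f x) (f y)

/-- The lattice points of the tile `Q + S z`, where `Q = (-1/2, …, -1/2) + [0, S]^{d-1}`. -/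
def latticeTile (d S : ℕ) (z : Fin (d - 1) → ℤ) : Set (Fin (d - 1) → ℤ) :=
  {x | ∀ i, (x i : ℝ) ∈ Set.Icc (-1 / 2 + (S : ℝ) * (z i : ℝ)) (-1 / 2 + (S : ℝ) + (S : ℝ) * (z i : ℝ))}

/-- The collection of all monotone increasing `ψ : [1, ∞) → [1, ∞)` with the following property.
For every positive integer `S` and every permutation `σ` of `ℤ^{d-1}` that restricts to a
permutation of each tile of side `S`, there is a `ψ(S)`-bilipschitz mapping `Υ : ℝ^d → ℝ^d` which
is the identity outside `ℝ^{d-1} × (-1/2, 1/2)` and satisfies `Υ(x, 0) = (σ(x), 0)` for all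
`x ∈ ℤ^{d-1}`.  A function on `[1, ∞)` is encoded as a function on `ℝ` whose values outside
`[1, ∞)` are irrelevant. -/
def permutationFamily (d : ℕ) : Set (ℝ → ℝ) :=
  {ψ | Set.MapsTo ψ (Set.Ici 1) (Set.Ici 1) ∧ MonotoneOn ψ (Set.Ici 1) ∧
    ∀ S : ℕ, 1 ≤ S → ∀ σ : Equiv.Perm (Fin (d - 1) → ℤ),
      (∀ z : Fin (d - 1) → ℤ, Set.BijOn σ (latticeTile d S z) (latticeTile d S z)) →
      ∃ Υ : EuclideanSpace ℝ (Fin d) → EuclideanSpace ℝ (Fin d),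
        IsBilipOn (ψ (S : ℝ)) Υ Set.univ ∧
        (∀ p ∈ cylinderOver d {h : ℝ | h ∉ Set.Ioo (-1 / 2 : ℝ) (1 / 2)}, Υ p = p) ∧
        ∀ x : Fin (d - 1) → ℤ, Υ (latticePoint d x 0) = latticePoint d (σ x) 0}

/-! The function β is the pointwise infimum of the family, so it inherits monotonicity. Its lower
bound comes from a permutation that tears neighbouring lattice points apart, its upper bound from
one explicit member of the family. Both that member and the extension F come from a single transport
construction.

Transport moves one separated configuration in a slab of ℝ^{d-1} × ℝ to another while fixing
everything outside the slab. Its building block is a shear x ↦ x + φ(x)v, with φ a McShane-type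
infimum (`exists_shear_extension`). If horizontal projections are separated, a shear lifts each
point to a height given by its colour. Disjoint boxes then carry the points horizontally, and a
second shear sets the final heights (`exists_transport`). Points of equal colour are far apart
horizontally and different colours lie on different levels, so the boxes do not meet. When
projections may coincide, a small horizontal perturbation separates them first and is undone at the
end (`exists_transport_of_separated`).

The extension does not decompose f into permutations. Transport gives a constant polynomial in L and
H for fixed d, and β enters only through β(T) ≥ 2⌊T⌋ - 1 ≥ T at the large argument T of the
statement. The power 3^{d-1} then absorbs the number of colours. -/

/-! ### Bilipschitz maps: composition, shears, gluing. -/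

theorem IsBilipOn.comp_univ {E F G : Type*} [MetricSpace E] [MetricSpace F] [MetricSpace G]
    {K M : ℝ} {g : F → G} {f : E → F} (hK : 0 ≤ K) (hM : 0 ≤ M)
    (hg : IsBilipOn K g Set.univ) (hf : IsBilipOn M f Set.univ) :
    IsBilipOn (K * M) (g ∘ f) Set.univ := by
  intro x _ y _
  obtain ⟨h1, h2⟩ := hg (f x) trivial (f y) trivial
  obtain ⟨h3, h4⟩ := hf x trivial y trivial
  constructor
  · calc dist (g (f x)) (g (f y)) ≤ K * dist (f x) (f y) := h1
      _ ≤ K * (M * dist x y) := by gcongr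
      _ = K * M * dist x y := by ring
  · calc dist x y ≤ M * dist (f x) (f y) := h4
      _ ≤ M * (K * dist (g (f x)) (g (f y))) := by gcongr
      _ = K * M * dist (g (f x)) (g (f y)) := by ring

theorem IsBilipOn.mono_const {E F : Type*} [MetricSpace E] [MetricSpace F]
    {K M : ℝ} {f : E → F} {A : Set E} (hf : IsBilipOn K f A) (hKM : K ≤ M) :
    IsBilipOn M f A := fun x hx y hy =>
  ⟨(hf x hx y hy).1.trans (by gcongr), (hf x hx y hy).2.trans (by gcongr)⟩

/-- A map `x ↦ x + φ x • v` is bilipschitz when `φ` is Lipschitz and does not decrease too fast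
in the direction `v`. -/
theorem isBilipOn_shear {E : Type*} [NormedAddCommGroup E] [NormedSpace ℝ E] (v : E)
    {l c : ℝ} (hl : 0 ≤ l) (hc : 0 < c) (hc1 : c ≤ 1) (φ : E → ℝ)
    (h1 : ∀ x k, φ (x + k) ≤ φ x + l * ‖k‖)
    (h2 : ∀ x τ, 0 ≤ τ → φ (x - τ • v) ≤ φ x + (1 - c) * τ) :
    IsBilipOn (1 + l * ‖v‖ / c) (fun x => x + φ x • v) Set.univ := by
  have hlip : ∀ x y, φ x - φ y ≤ l * ‖x - y‖ := fun x y => by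
    have := h1 y (x - y)
    rw [add_sub_cancel] at this
    linarith
  have hlip' : ∀ x y, |φ x - φ y| ≤ l * ‖x - y‖ := fun x y => by
    rw [abs_le]
    constructor
    · have := hlip y x
      rw [norm_sub_rev] at this
      linarith
    · exact hlip x y
  -- the one-sided estimate behind the lower bound
  have key : ∀ x y, φ y ≤ φ x → φ x - φ y ≤ l * ‖(x + φ x • v) - (y + φ y • v)‖ / c := by
    intro x y hxy
    set τ := φ x - φ y with hτ
    set w := (x + φ x • v) - (y + φ y • v) with hw
    have hx : x = (y - τ • v) + w := by
      rw [hw, hτ, sub_smul]; abel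
    have e1 := h1 (y - τ • v) w
    rw [← hx] at e1
    have e2 := h2 y τ (by linarith)
    rw [le_div_iff₀ hc]
    nlinarith
  have key' : ∀ x y, |φ x - φ y| ≤ l * ‖(x + φ x • v) - (y + φ y • v)‖ / c := by
    intro x y
    rcases le_total (φ y) (φ x) with h | h
    · rw [abs_of_nonneg (by linarith)]
      exact key x y h
    · rw [abs_sub_comm, abs_of_nonneg (by linarith), norm_sub_rev]
      exact key y x h
  intro x _ y _
  simp only [dist_eq_norm]
  have hdiv : l * ‖v‖ ≤ l * ‖v‖ / c := by
    rw [le_div_iff₀ hc]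
    have : 0 ≤ l * ‖v‖ := by positivity
    nlinarith
  constructor
  · calc ‖x + φ x • v - (y + φ y • v)‖ = ‖(x - y) + (φ x - φ y) • v‖ := by
          congr 1; rw [sub_smul]; abel
      _ ≤ ‖x - y‖ + |φ x - φ y| * ‖v‖ := by
          refine (norm_add_le _ _).trans ?_
          rw [norm_smul, Real.norm_eq_abs]
      _ ≤ ‖x - y‖ + (l * ‖x - y‖) * ‖v‖ := by gcongr; exact hlip' x y
      _ = (1 + l * ‖v‖) * ‖x - y‖ := by ring
      _ ≤ _ := by gcongr
  · set w := x + φ x • v - (y + φ y • v) with hw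
    calc ‖x - y‖ = ‖w - (φ x - φ y) • v‖ := by
          congr 1; rw [hw, sub_smul]; abel
      _ ≤ ‖w‖ + |φ x - φ y| * ‖v‖ := by
          refine (norm_sub_le _ _).trans ?_
          rw [norm_smul, Real.norm_eq_abs]
      _ ≤ ‖w‖ + (l * ‖w‖ / c) * ‖v‖ := by gcongr; exact key' x y
      _ = (1 + l * ‖v‖ / c) * ‖w‖ := by ring

/-- McShane extension with an asymmetric gauge: prescribed displacements `t i` in the direction
`v` at the points `a i` extend to a bilipschitz map. -/
theorem exists_shear_extension {E ι : Type*} [NormedAddCommGroup E] [NormedSpace ℝ E]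
    [Nonempty ι] (v : E) {l c : ℝ} (hl : 0 ≤ l) (hc : 0 < c) (hc1 : c ≤ 1)
    (a : ι → E) (t : ι → ℝ)
    (h : ∀ i j, ∀ τ : ℝ, 0 ≤ τ → t i - t j ≤ l * ‖a i - a j + τ • v‖ + (1 - c) * τ) :
    ∃ F : E → E, IsBilipOn (1 + l * ‖v‖ / c) F Set.univ ∧ ∀ i, F (a i) = a i + t i • v := by
  -- The gauge is the infimum over τ ≥ 0 of l‖w + τv‖ + (1 - c)τ: slope l in general, but stepping
  -- by -τv costs only (1 - c)τ. This one-sided bound keeps the shear from folding along v.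
  let g : E → ι × {τ : ℝ // 0 ≤ τ} → ℝ := fun x i =>
    t i.1 + l * ‖x - a i.1 + (i.2 : ℝ) • v‖ + (1 - c) * i.2
  let φ : E → ℝ := fun x => ⨅ i, g x i
  have : Nonempty (ι × {τ : ℝ // 0 ≤ τ}) := ⟨⟨Classical.arbitrary ι, 0, le_rfl⟩⟩
  have hbdd : ∀ x, BddBelow (Set.range (g x)) := by
    intro x
    let j : ι := Classical.arbitrary ι
    refine ⟨t j - l * ‖a j - x‖, ?_⟩
    rintro _ ⟨⟨i, τ, hτ⟩, rfl⟩
    have e1 := h j i τ hτ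
    have e2 : ‖a j - a i + τ • v‖ ≤ ‖a j - x‖ + ‖x - a i + τ • v‖ := by
      refine le_trans (le_of_eq ?_) (norm_add_le _ _)
      congr 1; abel
    have e3 := mul_le_mul_of_nonneg_left e2 hl
    simp only [g]
    linarith
  have h1 : ∀ x k, φ (x + k) ≤ φ x + l * ‖k‖ := by
    intro x k
    rw [← sub_le_iff_le_add]
    refine le_ciInf fun i => ?_
    have e1 := ciInf_le (hbdd (x + k)) i
    have e2 : ‖x + k - a i.1 + (i.2 : ℝ) • v‖ ≤ ‖x - a i.1 + (i.2 : ℝ) • v‖ + ‖k‖ := by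
      refine le_trans (le_of_eq ?_) (norm_add_le _ _)
      congr 1; abel
    have e3 := mul_le_mul_of_nonneg_left e2 hl
    simp only [g, φ] at e1 ⊢
    linarith
  have h2 : ∀ x τ, 0 ≤ τ → φ (x - τ • v) ≤ φ x + (1 - c) * τ := by
    intro x τ hτ
    rw [← sub_le_iff_le_add]
    refine le_ciInf fun i => ?_
    have e1 := ciInf_le (hbdd (x - τ • v)) ⟨i.1, i.2 + τ, add_nonneg i.2.2 hτ⟩
    have e2 : x - τ • v - a i.1 + ((i.2 : ℝ) + τ) • v = x - a i.1 + (i.2 : ℝ) • v := by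
      rw [add_smul]; abel
    simp only [g, φ] at e1 ⊢
    rw [e2] at e1
    linarith
  refine ⟨_, isBilipOn_shear v hl hc hc1 φ h1 h2, fun i => ?_⟩
  have : φ (a i) = t i := by
    apply le_antisymm
    · refine (ciInf_le (hbdd (a i)) ⟨i, 0, le_rfl⟩).trans ?_
      simp [g]
    · refine le_ciInf fun j => ?_
      have := h i j.1 j.2 j.2.2
      simp only [g]
      linarith
  simp only [this]

/-- Bilipschitz maps that are the identity off disjoint sets can be glued. -/
theorem exists_glue {E P : Type*} [MetricSpace E] {M : ℝ} (hM : 0 ≤ M) (U : P → Set E)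
    (G : P → E → E) (hU : ∀ p q x, x ∈ U p → x ∈ U q → p = q)
    (hG : ∀ p, IsBilipOn M (G p) Set.univ) (hid : ∀ p, ∀ x ∉ U p, G p x = x) :
    ∃ F : E → E, IsBilipOn (2 * M + 3) F Set.univ ∧ (∀ p, ∀ x ∈ U p, F x = G p x) ∧
      ∀ x, (∀ p, x ∉ U p) → F x = x := by
  classical
  let F : E → E := fun x => if hx : ∃ p, x ∈ U p then G hx.choose x else x
  have hF1 : ∀ p, ∀ x ∈ U p, F x = G p x := by
    intro p x hx
    have hex : ∃ p, x ∈ U p := ⟨p, hx⟩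
    simp only [F, dif_pos hex]
    rw [hU _ _ x hex.choose_spec hx]
  have hF2 : ∀ x, (∀ p, x ∉ U p) → F x = x := by
    intro x hx
    simp only [F]
    rw [dif_neg (by push Not; exact hx)]
  have hmem : ∀ p, ∀ x ∈ U p, F x ∈ U p := by
    intro p x hx
    by_contra hn
    have e1 := hid p _ hn
    rw [hF1 p x hx] at e1 hn
    have e2 := (hG p (G p x) trivial x trivial).2
    rw [e1, dist_self, mul_zero] at e2
    rw [dist_le_zero.1 e2] at hn
    exact hn hx
  have hnmem : ∀ p, ∀ y ∉ U p, F y ∉ U p := by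
    intro p y hy hFy
    by_cases hex : ∃ q, y ∈ U q
    · obtain ⟨q, hq⟩ := hex
      exact hy (hU p q _ hFy (hmem q y hq) ▸ hq)
    · rw [hF2 y (not_exists.1 hex)] at hFy
      exact hy hFy
  -- the displacement at `x` is controlled by the distance to any point off the piece of `x`
  have hdisp : ∀ x y, (∀ p, x ∈ U p → y ∉ U p) →
      dist (F x) x ≤ (M + 1) * dist x y ∧ dist (F x) x ≤ (M + 1) * dist (F x) (F y) := by
    intro x y hxy
    by_cases hex : ∃ p, x ∈ U p
    · obtain ⟨p, hp⟩ := hex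
      have hy := hxy p hp
      constructor
      · have e := (hG p x trivial y trivial).1
        rw [hid p y hy, ← hF1 p x hp] at e
        have := dist_triangle (F x) y x
        rw [dist_comm y x] at this
        linarith
      · have e := (hG p x trivial (F y) trivial).2
        rw [hid p _ (hnmem p y hy), ← hF1 p x hp] at e
        have := dist_triangle_right (F x) x (F y)
        linarith
    · rw [hF2 x (not_exists.1 hex), dist_self]
      constructor <;> positivity
  refine ⟨F, ?_, hF1, hF2⟩
  intro x _ y _
  by_cases hex : ∃ p, x ∈ U p ∧ y ∈ U p
  · obtain ⟨p, hx, hy⟩ := hex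
    rw [hF1 p x hx, hF1 p y hy]
    exact ((hG p).mono_const (by linarith)) x trivial y trivial
  · obtain ⟨a1, a2⟩ := hdisp x y fun p hx hy => hex ⟨p, hx, hy⟩
    obtain ⟨b1, b2⟩ := hdisp y x fun p hy hx => hex ⟨p, hx, hy⟩
    rw [dist_comm y x] at b1
    rw [dist_comm (F y) (F x)] at b2
    have c1 := dist_triangle4 (F x) x y (F y)
    have c2 := dist_triangle4 x (F x) (F y) y
    rw [dist_comm y (F y)] at c1
    rw [dist_comm x (F x)] at c2
    constructor <;> linarith

/-! ### Elementary moves in a slab. -/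

/-- Moving points of `X × ℝ` vertically inside the slab `lo < y < hi`. -/
theorem exists_vertical_move {X P : Type*} [NormedAddCommGroup X] [NormedSpace ℝ X]
    {lo hi κ r r' T l c : ℝ} (a : P → X × ℝ) (y : P → ℝ)
    (hκ : ∀ p q, p ≠ q → κ ≤ ‖(a p).1 - (a q).1‖)
    (ha : ∀ p, (a p).2 ∈ Set.Icc (lo + r) (hi - r)) (hy : ∀ p, y p ∈ Set.Icc (lo + r') (hi - r'))
    (hT : ∀ p, |y p - (a p).2| ≤ T) (hl : 1 ≤ l) (hc : 0 < c) (hc1 : c ≤ 1)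
    (hlκ : 2 * T ≤ l * κ) (hlr : T ≤ l * r) (hr : 0 ≤ r) (hcr : c * (hi - lo) ≤ r') :
    ∃ F : X × ℝ → X × ℝ, IsBilipOn (1 + l / c) F Set.univ ∧
      (∀ p, F (a p) = ((a p).1, y p)) ∧ ∀ e : X × ℝ, e.2 ∉ Set.Ioo lo hi → F e = e := by
  -- The fixed points outside the slab join the prescribed data, which makes the index type nonempty
  -- even for empty `P`.
  have hne : Nonempty ({e : X × ℝ // e.2 ∉ Set.Ioo lo hi}) := ⟨⟨((0 : X), lo), by simp⟩⟩
  have hv : ‖((0 : X), (1 : ℝ))‖ = 1 := by simp [Prod.norm_def]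
  have hsnd : ∀ e : X × ℝ, |e.2| ≤ ‖e‖ := fun e => norm_snd_le e
  have hfst : ∀ e : X × ℝ, ‖e.1‖ ≤ ‖e‖ := fun e => norm_fst_le e
  have habs : ∀ p, y p - (a p).2 ≤ T ∧ (a p).2 - y p ≤ T := fun p => by
    have := abs_le.1 (hT p)
    constructor <;> linarith
  obtain ⟨F, hF, hFa⟩ := exists_shear_extension (ι := P ⊕ {e : X × ℝ // e.2 ∉ Set.Ioo lo hi})
    ((0 : X), (1 : ℝ)) (l := l) (c := c) (by linarith) hc hc1 (Sum.elim a (fun e => e.1))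
    (Sum.elim (fun p => y p - (a p).2) (fun _ => 0)) (by
      rintro (p | ⟨e, he⟩) (q | ⟨e', he'⟩) τ hτ
      · have hτ' : 0 ≤ (1 - c) * τ := mul_nonneg (by linarith) hτ
        simp only [Sum.elim_inl]
        by_cases hpq : p = q
        · subst hpq
          rw [sub_self]; positivity
        · have e1 := hfst (a p - a q + τ • ((0 : X), (1 : ℝ)))
          simp only [Prod.fst_add, Prod.fst_sub, Prod.smul_fst, smul_zero, add_zero] at e1
          have e2 := (hκ p q hpq).trans e1
          have e3 := mul_le_mul_of_nonneg_left e2 (by linarith : 0 ≤ l)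
          have := habs p
          have := habs q
          linarith
      -- Against a fixed point below the slab slope l suffices, as T ≤ l r. Against one above, the
      -- gap hi - (a p).2 may shrink at most by the factor c; this holds because hi - y p ≥ r' ≥
      -- c(hi - lo). The next case is the mirror image.
      · simp only [Sum.elim_inl, Sum.elim_inr, sub_zero]
        have e1 := hsnd (a p - e' + τ • ((0 : X), (1 : ℝ)))
        simp only [Prod.snd_add, Prod.snd_sub, Prod.smul_snd, smul_eq_mul, mul_one] at e1
        have e3 := mul_le_mul_of_nonneg_left e1 (by linarith : 0 ≤ l)
        have hap := ha p
        have hyp := hy p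
        have := habs p
        have hcτ : 0 ≤ (1 - c) * τ := mul_nonneg (by linarith) hτ
        simp only [Set.mem_Ioo, not_and_or, not_lt, Set.mem_Icc] at he' hap hyp
        rcases he' with h | h
        · have : r ≤ |(a p).2 - e'.2 + τ| := by
            refine le_trans ?_ (le_abs_self _); linarith
          have := mul_le_mul_of_nonneg_left this (by linarith : 0 ≤ l)
          linarith
        · have e4 : e'.2 - (a p).2 - τ ≤ |(a p).2 - e'.2 + τ| := by
            refine le_trans (le_of_eq ?_) (neg_le_abs _); ring
          have e5 : |(a p).2 - e'.2 + τ| ≤ l * |(a p).2 - e'.2 + τ| :=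
            le_mul_of_one_le_left (abs_nonneg _) hl
          by_cases h6 : τ ≤ e'.2 - (a p).2
          · nlinarith [mul_nonneg hc.le (by linarith : 0 ≤ (a p).2 - lo), mul_nonneg hc.le (by linarith : 0 ≤ hi - (a p).2), mul_nonneg hc.le (by linarith : 0 ≤ e'.2 - hi), mul_nonneg (by linarith : 0 ≤ 1 - c) (by linarith : 0 ≤ e'.2 - hi)]
          · have h7 := mul_nonneg (by linarith : 0 ≤ 1 - c) (by linarith : 0 ≤ τ - (e'.2 - (a p).2))
            have h8 : 0 ≤ |(a p).2 - e'.2 + τ| := abs_nonneg _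
            nlinarith [mul_nonneg hc.le (by linarith : 0 ≤ (a p).2 - lo), mul_nonneg (by linarith : 0 ≤ 1 - c) (by linarith : 0 ≤ e'.2 - hi)]
      · simp only [Sum.elim_inl, Sum.elim_inr, zero_sub, neg_sub]
        have e1 := hsnd (e - a q + τ • ((0 : X), (1 : ℝ)))
        simp only [Prod.snd_add, Prod.snd_sub, Prod.smul_snd, smul_eq_mul, mul_one] at e1
        have e3 := mul_le_mul_of_nonneg_left e1 (by linarith : 0 ≤ l)
        have hap := ha q
        have hyp := hy q
        have := habs q
        have hcτ : 0 ≤ (1 - c) * τ := mul_nonneg (by linarith) hτ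
        simp only [Set.mem_Ioo, not_and_or, not_lt, Set.mem_Icc] at he hap hyp
        rcases he with h | h
        · have e4 : (a q).2 - e.2 - τ ≤ |e.2 - (a q).2 + τ| := by
            refine le_trans (le_of_eq ?_) (neg_le_abs _); ring
          have e5 : |e.2 - (a q).2 + τ| ≤ l * |e.2 - (a q).2 + τ| :=
            le_mul_of_one_le_left (abs_nonneg _) hl
          by_cases h6 : τ ≤ (a q).2 - e.2
          · nlinarith [mul_nonneg hc.le (by linarith : 0 ≤ hi - (a q).2), mul_nonneg (by linarith : 0 ≤ 1 - c) (by linarith : 0 ≤ lo - e.2), mul_nonneg hc.le (by linarith : 0 ≤ (a q).2 - e.2 - τ)]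
          · have h7 := mul_nonneg (by linarith : 0 ≤ 1 - c) (by linarith : 0 ≤ τ - ((a q).2 - e.2))
            have h8 : 0 ≤ |e.2 - (a q).2 + τ| := abs_nonneg _
            nlinarith [mul_nonneg hc.le (by linarith : 0 ≤ hi - (a q).2), mul_nonneg (by linarith : 0 ≤ 1 - c) (by linarith : 0 ≤ lo - e.2)]
        · have : r ≤ |e.2 - (a q).2 + τ| := by
            refine le_trans ?_ (le_abs_self _); linarith
          have := mul_le_mul_of_nonneg_left this (by linarith : 0 ≤ l)
          linarith
      · simp only [Sum.elim_inr, sub_self]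
        have := mul_nonneg (by linarith : 0 ≤ 1 - c) hτ
        positivity)
  rw [hv, mul_one] at hF
  refine ⟨F, hF, fun p => ?_, fun e he => ?_⟩
  · have := hFa (Sum.inl p)
    simp only [Sum.elim_inl] at this
    rw [this]
    ext <;> simp
  · simpa using hFa (Sum.inr ⟨e, he⟩)

/-- Small horizontal displacements, all in the direction `u`, of separated points of a slab. -/
theorem exists_horizontal_perturbation {X P : Type*} [NormedAddCommGroup X] [NormedSpace ℝ X]
    {lo hi ρ : ℝ} (u : X) (hu : ‖u‖ = 1) (a : P → X × ℝ) (s : P → ℝ) (hρ : 0 ≤ ρ)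
    (hsep : ∀ p q, p ≠ q → ρ ≤ ‖a p - a q‖)
    (ha : ∀ p, (a p).2 ∈ Set.Icc (lo + ρ) (hi - ρ)) (hs : ∀ p, |s p| ≤ ρ / 4) :
    ∃ F : X × ℝ → X × ℝ, IsBilipOn 3 F Set.univ ∧
      (∀ p, F (a p) = ((a p).1 + s p • u, (a p).2)) ∧
      ∀ e : X × ℝ, e.2 ∉ Set.Ioo lo hi → F e = e := by
  have hne : Nonempty ({e : X × ℝ // e.2 ∉ Set.Ioo lo hi}) := ⟨⟨((0 : X), lo), by simp⟩⟩
  have hv : ‖(u, (0 : ℝ))‖ = 1 := by simp [Prod.norm_def, hu]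
  have habs : ∀ p, s p ≤ ρ / 4 ∧ - s p ≤ ρ / 4 := fun p =>
    ⟨(le_abs_self _).trans (hs p), (neg_le_abs _).trans (hs p)⟩
  have hout : ∀ p, ∀ e : X × ℝ, e.2 ∉ Set.Ioo lo hi → ρ ≤ ‖a p - e‖ := by
    intro p e he
    refine le_trans ?_ (norm_snd_le _)
    have hap := ha p
    simp only [Set.mem_Ioo, not_and_or, not_lt, Set.mem_Icc, Prod.snd_sub, Real.norm_eq_abs]
      at he hap ⊢
    rcases he with h | h
    · refine le_trans ?_ (le_abs_self _); linarith
    · refine le_trans ?_ (neg_le_abs _); linarith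
  -- Two displacements differ by at most ρ/2, so this covers all pairs with l = 1 and c = 1/2,
  -- whence the constant 3.
  have key : ∀ w : X × ℝ, ρ ≤ ‖w‖ → ∀ τ : ℝ, 0 ≤ τ →
      ρ / 2 ≤ 1 * ‖w + τ • (u, (0 : ℝ))‖ + (1 - 1 / 2) * τ := by
    intro w hw τ hτ
    have e1 : ‖w‖ ≤ ‖w + τ • (u, (0 : ℝ))‖ + τ := by
      have := norm_sub_le (w + τ • (u, (0 : ℝ))) (τ • (u, (0 : ℝ)))
      rwa [add_sub_cancel_right, norm_smul, hv, mul_one, Real.norm_of_nonneg hτ] at this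
    have := norm_nonneg (w + τ • (u, (0 : ℝ)))
    linarith
  obtain ⟨F, hF, hFa⟩ := exists_shear_extension (ι := P ⊕ {e : X × ℝ // e.2 ∉ Set.Ioo lo hi})
    (u, (0 : ℝ)) (l := 1) (c := 1 / 2) (by norm_num) (by norm_num) (by norm_num)
    (Sum.elim a (fun e => e.1)) (Sum.elim s (fun _ => 0)) (by
      rintro (p | ⟨e, he⟩) (q | ⟨e', he'⟩) τ hτ
      · simp only [Sum.elim_inl]
        by_cases hpq : p = q
        · subst hpq
          rw [sub_self]; positivity
        · have := key _ (hsep p q hpq) τ hτ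
          have := habs p
          have := habs q
          linarith
      · simp only [Sum.elim_inl, Sum.elim_inr]
        have := key _ (hout p e' he') τ hτ
        have := habs p
        linarith
      · simp only [Sum.elim_inl, Sum.elim_inr]
        have := key (e - a q) (by rw [norm_sub_rev]; exact hout q e he) τ hτ
        have := habs q
        linarith
      · simp only [Sum.elim_inr, sub_self]
        positivity)
  rw [hv] at hF
  refine ⟨F, by norm_num at hF; exact hF, fun p => ?_, fun e he => ?_⟩
  · have := hFa (Sum.inl p)
    simp only [Sum.elim_inl] at this
    rw [this]
    ext <;> simp
  · simpa using hFa (Sum.inr ⟨e, he⟩)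

/-- Moving one point horizontally inside a box. -/
theorem exists_box_move {X : Type*} [NormedAddCommGroup X] [NormedSpace ℝ X]
    {D δ : ℝ} (α v : X) (η : ℝ) (hv : ‖v‖ ≤ D) (hδ : 0 < δ) :
    ∃ F : X × ℝ → X × ℝ, IsBilipOn (1 + 2 * D / δ) F Set.univ ∧ F (α, η) = (α + v, η) ∧
      ∀ e : X × ℝ, e ∉ {e : X × ℝ | ‖e.1 - α‖ < 2 * D + δ ∧ |e.2 - η| < δ} → F e = e := by
  set U := {e : X × ℝ | ‖e.1 - α‖ < 2 * D + δ ∧ |e.2 - η| < δ} with hU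
  have hD : 0 ≤ D := (norm_nonneg v).trans hv
  have hV : ‖(v, (0 : ℝ))‖ = ‖v‖ := by simp [Prod.norm_def]
  obtain ⟨F, hF, hFa⟩ := exists_shear_extension (ι := Unit ⊕ {e : X × ℝ // e ∉ U})
    (v, (0 : ℝ)) (l := 1 / δ) (c := 1 / 2) (by positivity) (by norm_num) (by norm_num)
    (Sum.elim (fun _ => (α, η)) (fun e => e.1)) (Sum.elim (fun _ => 1) (fun _ => 0)) (by
      rintro (p | ⟨e, he⟩) (q | ⟨e', he'⟩) τ hτ
      · simp only [Sum.elim_inl, sub_self]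
        positivity
      · simp only [Sum.elim_inl, Sum.elim_inr, sub_zero]
        -- The displacement 1 is paid by (1 - c)τ once τ ≥ 2. For smaller τ the drift τv is at most
        -- 2D, which explains the horizontal radius 2D + δ.
        by_cases h2 : 2 ≤ τ
        · have : 0 ≤ 1 / δ * ‖(α, η) - e' + τ • (v, (0 : ℝ))‖ := by positivity
          linarith
        · have : δ ≤ ‖(α, η) - e' + τ • (v, (0 : ℝ))‖ := by
            simp only [hU, Set.mem_ofPred_eq, not_and_or, not_lt] at he'
            rcases he' with h | h
            · refine le_trans ?_ (norm_fst_le _)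
              simp only [Prod.fst_add, Prod.fst_sub, Prod.smul_fst]
              have e1 := norm_sub_le (α - e'.1 + τ • v) (τ • v)
              rw [add_sub_cancel_right, norm_smul, Real.norm_of_nonneg hτ, norm_sub_rev] at e1
              have : τ * ‖v‖ ≤ 2 * D := by
                have := norm_nonneg v
                nlinarith
              linarith
            · refine le_trans ?_ (norm_snd_le _)
              simp only [Prod.snd_add, Prod.snd_sub, Prod.smul_snd, smul_zero, add_zero]
              rwa [Real.norm_eq_abs, abs_sub_comm]
          have e2 : 1 ≤ 1 / δ * ‖(α, η) - e' + τ • (v, (0 : ℝ))‖ := by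
            rw [one_div_mul_eq_div, le_div_iff₀ hδ]; linarith
          linarith
      · simp only [Sum.elim_inl, Sum.elim_inr]
        have : 0 ≤ 1 / δ * ‖e - (α, η) + τ • (v, (0 : ℝ))‖ := by positivity
        linarith
      · simp only [Sum.elim_inr, sub_self]
        positivity)
  refine ⟨F, hF.mono_const ?_, ?_, fun e he => ?_⟩
  · rw [hV]
    have : 1 / δ * ‖v‖ / (1 / 2) = 2 * ‖v‖ / δ := by field_simp
    rw [this]
    gcongr
  · have := hFa (Sum.inl ())
    simp only [Sum.elim_inl] at this
    rw [this]
    ext <;> simp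
  · simpa using hFa (Sum.inr ⟨e, he⟩)

/-! ### Transport of separated configurations. -/

/-- Two configurations in a slab of `X × ℝ` whose horizontal projections are separated are related
by a bilipschitz map, provided the points can be coloured so that points of equal colour are far
apart horizontally. -/
theorem exists_transport {X P C : Type*} [NormedAddCommGroup X] [NormedSpace ℝ X] [Fintype C]
    [Nonempty C] {lo hi κ r D l c : ℝ} (χ : P → C) (a b : P → X × ℝ) (hh : lo < hi)
    (hr : 0 ≤ r) (ha : ∀ p, (a p).2 ∈ Set.Icc (lo + r) (hi - r))
    (hb : ∀ p, (b p).2 ∈ Set.Icc (lo + r) (hi - r)) (hD0 : 0 ≤ D)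
    (hD : ∀ p, ‖(b p).1 - (a p).1‖ ≤ D)
    (hfar : ∀ p q, p ≠ q → χ p = χ q → 4 * D + (hi - lo) ≤ ‖(a p).1 - (a q).1‖)
    (haκ : ∀ p q, p ≠ q → κ ≤ ‖(a p).1 - (a q).1‖)
    (hbκ : ∀ p q, p ≠ q → κ ≤ ‖(b p).1 - (b q).1‖)
    (hl : 3 ≤ l) (hlκ : 3 * (hi - lo) / 2 ≤ l * κ) (hlr : 3 * (hi - lo) / 4 ≤ l * r)
    (hc : 0 < c) (hc1 : c ≤ 1 / 4) (hcr : c * (hi - lo) ≤ r) :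
    ∃ F : X × ℝ → X × ℝ,
      IsBilipOn ((1 + l / c) ^ 2 * (5 + 16 * D * Fintype.card C / (hi - lo))) F Set.univ ∧
      (∀ p, F (a p) = b p) ∧ ∀ e : X × ℝ, e.2 ∉ Set.Ioo lo hi → F e = e := by
  set h := hi - lo with hdef
  have hh' : 0 < h := by rw [hdef]; linarith
  set N := Fintype.card C with hN
  have hN0 : (1 : ℝ) ≤ N := by exact_mod_cast (Fintype.card_pos : 0 < Fintype.card C)
  have hNpos : (0 : ℝ) < N := by linarith
  set δ := h / (4 * N) with hδ
  have hδ0 : 0 < δ := by positivity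
  have hδN : 4 * (N * δ) = h := by rw [hδ]; field_simp
  have hδh : δ ≤ h / 4 := by nlinarith
  let k : C → ℝ := fun x => ((Fintype.equivFin C x : ℕ) : ℝ)
  have hk0 : ∀ x, 0 ≤ k x := fun x => Nat.cast_nonneg _
  have hkN : ∀ x, k x + 1 ≤ N := fun x => by
    have := (Fintype.equivFin C x).2
    simp only [k]
    exact_mod_cast this
  have hk1 : ∀ x y, x ≠ y → 1 ≤ |k x - k y| := fun x y hxy => by
    have hne : ((Fintype.equivFin C x : ℕ) : ℤ) - ((Fintype.equivFin C y : ℕ) : ℤ) ≠ 0 := by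
      intro h0
      apply hxy
      apply (Fintype.equivFin C).injective
      apply Fin.ext
      omega
    have := Int.one_le_abs hne
    simp only [k]
    exact_mod_cast this
  -- The middle half of the slab is cut into N layers of thickness 2δ; each colour gets the
  -- midheight of its own layer.
  let η : P → ℝ := fun p => lo + h / 4 + (2 * k (χ p) + 1) * δ
  have hη : ∀ p, η p ∈ Set.Icc (lo + h / 4) (hi - h / 4) := by
    intro p
    have h0 := hk0 (χ p)
    have h1 := hkN (χ p)
    have h2 : 0 ≤ (2 * k (χ p) + 1) * δ := by positivity
    have h3 : (2 * k (χ p) + 1) * δ ≤ 2 * N * δ := by gcongr; linarith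
    simp only [η, Set.mem_Icc]
    constructor <;> linarith
  have hdist : ∀ (x : P → X × ℝ), (∀ p, (x p).2 ∈ Set.Icc (lo + r) (hi - r)) → ∀ p,
      |η p - (x p).2| ≤ 3 * h / 4 := by
    intro x hx p
    have h1 := hη p
    have h2 := hx p
    simp only [Set.mem_Icc] at h1 h2
    rw [abs_le]
    constructor <;> linarith
  obtain ⟨F₁, hF₁, hF₁a, hF₁id⟩ := exists_vertical_move (l := l) (r := r) (r' := h / 4) (T := 3 * h / 4)
    a η haκ ha hη (hdist a ha) (by linarith) hc (by linarith) (by linarith) hlr hr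
    (by rw [← hdef]; nlinarith)
  obtain ⟨F₃, hF₃, hF₃a, hF₃id⟩ := exists_vertical_move (l := l) (r := h / 4) (r' := r) (T := 3 * h / 4)
    (fun p => ((b p).1, η p)) (fun p => (b p).2) hbκ hη hb
    (fun p => by rw [abs_sub_comm]; exact hdist b hb p) (by linarith) hc (by linarith)
    (by linarith) (by nlinarith) (by linarith) hcr
  choose G hG hGa hGid using fun p => exists_box_move (a p).1 ((b p).1 - (a p).1) (η p) (hD p) hδ0
  obtain ⟨F₂, hF₂, hF₂a, hF₂id⟩ := exists_glue (M := 1 + 2 * D / δ) (by positivity)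
    (fun p => {e : X × ℝ | ‖e.1 - (a p).1‖ < 2 * D + δ ∧ |e.2 - η p| < δ}) G (by
      rintro p q x ⟨hx1, hx2⟩ ⟨hy1, hy2⟩
      by_contra hpq
      -- Equal colours: the horizontal distance 4D + h exceeds two box radii 2(2D + δ), as δ ≤ h/4.
      -- Different colours: the midheights differ by at least 2δ.
      by_cases hχ : χ p = χ q
      · have h1 := hfar p q hpq hχ
        have h2 : ‖(a p).1 - (a q).1‖ ≤ ‖x.1 - (a p).1‖ + ‖x.1 - (a q).1‖ := by
          have := norm_sub_le (x.1 - (a q).1) (x.1 - (a p).1)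
          rw [sub_sub_sub_cancel_left] at this
          linarith
        linarith
      · have h1 := hk1 _ _ hχ
        have h2 : |η p - η q| = |k (χ p) - k (χ q)| * (2 * δ) := by
          have : η p - η q = (k (χ p) - k (χ q)) * (2 * δ) := by
            simp only [η]; ring
          rw [this, abs_mul, abs_of_pos (by positivity : 0 < 2 * δ)]
        have h3 : |η p - η q| ≤ |x.2 - η q| + |x.2 - η p| := by
          have := abs_sub (x.2 - η q) (x.2 - η p)
          rwa [sub_sub_sub_cancel_left] at this
        nlinarith) hG hGid
  have hl0 : 0 ≤ 1 + l / c := by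
    have : 0 ≤ l := by linarith
    positivity
  have hM2 : 0 ≤ 2 * (1 + 2 * D / δ) + 3 := by positivity
  refine ⟨F₃ ∘ (F₂ ∘ F₁), ?_, fun p => ?_, fun e he => ?_⟩
  · refine (hF₃.comp_univ hl0 (by positivity) (hF₂.comp_univ hM2 hl0 hF₁)).mono_const (le_of_eq ?_)
    have : 2 * D / δ = 8 * D * N / h := by
      rw [hδ]; field_simp; ring
    rw [this]
    ring
  · simp only [Function.comp]
    rw [hF₁a, hF₂a p, hGa]
    · rw [add_sub_cancel, hF₃a p]
    · simp only [Set.mem_ofPred_eq, sub_self, norm_zero, abs_zero]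
      exact ⟨by positivity, hδ0⟩
  · simp only [Function.comp]
    rw [hF₁id e he, hF₂id, hF₃id e he]
    rintro p ⟨-, hp⟩
    apply he
    have h1 := hη p
    simp only [Set.mem_Icc] at h1
    rw [abs_lt] at hp
    constructor <;> linarith

/-- A real number moved to a nearby point of the grid of mesh `τ`, shifted according to `k`. -/
theorem exists_grid_shift {P : Type*} {N : ℕ} {τ : ℝ} (hτ : 0 < τ) (x : P → ℝ) (k : P → Fin N) :
    ∃ s : P → ℝ, (∀ p, |s p| ≤ τ) ∧
      ∀ p q, k p ≠ k q → τ / N ≤ |(x p + s p) - (x q + s q)| := by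
  rcases Nat.eq_zero_or_pos N with rfl | hN
  · have : IsEmpty P := ⟨fun p => (k p).elim0⟩
    exact ⟨fun _ => 0, fun p => (IsEmpty.false p).elim, fun p => (IsEmpty.false p).elim⟩
  have hN' : (0 : ℝ) < N := by exact_mod_cast hN
  -- Shifted values are integer multiples of τ/N whose residue mod N is the colour, so different
  -- colours differ by at least τ/N.
  have hx : ∀ p, x p + ((⌊x p / τ⌋ : ℝ) * τ + (k p : ℕ) * (τ / N) - x p) =
      (⌊x p / τ⌋ * N + (k p : ℕ)) * (τ / N) := fun p => by field_simp; ring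
  refine ⟨fun p => (⌊x p / τ⌋ : ℝ) * τ + (k p : ℕ) * (τ / N) - x p, fun p => ?_,
    fun p q hpq => ?_⟩
  · have h1 := Int.floor_le (x p / τ)
    have h2 := Int.lt_floor_add_one (x p / τ)
    rw [le_div_iff₀ hτ] at h1
    rw [div_lt_iff₀ hτ] at h2
    have h3 : ((k p : ℕ) : ℝ) * (τ / N) ≤ τ := by
      rw [← mul_div_assoc, div_le_iff₀ hN']
      have : ((k p : ℕ) : ℝ) ≤ N := by exact_mod_cast (k p).2.le
      nlinarith
    have h4 : 0 ≤ ((k p : ℕ) : ℝ) * (τ / N) := by positivity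
    rw [abs_le]
    constructor <;> linarith
  · simp only [hx, ← sub_mul]
    rw [abs_mul, abs_of_pos (by positivity : 0 < τ / N)]
    refine le_mul_of_one_le_left (by positivity) ?_
    have hne : ⌊x p / τ⌋ * (N : ℤ) + ((k p : ℕ) : ℤ) - (⌊x q / τ⌋ * (N : ℤ) + ((k q : ℕ) : ℤ)) ≠ 0 := by
      intro h0
      apply hpq
      apply Fin.ext
      have hp := (k p).2
      have hq := (k q).2
      have h5 : ((k p : ℕ) : ℤ) - ((k q : ℕ) : ℤ) = (⌊x q / τ⌋ - ⌊x p / τ⌋) * (N : ℤ) := by linarith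
      have h6 : (⌊x q / τ⌋ - ⌊x p / τ⌋ : ℤ) = 0 := by
        by_contra hne
        have := Int.one_le_abs hne
        have h7 : |((k p : ℕ) : ℤ) - ((k q : ℕ) : ℤ)| < N := by
          rw [abs_lt]; constructor <;> omega
        rw [h5, abs_mul, abs_of_nonneg (by positivity : (0 : ℤ) ≤ N)] at h7
        nlinarith
      rw [h6] at h5
      omega
    exact_mod_cast Int.one_le_abs hne

/-- Two separated configurations in a slab of `ℝⁿ × ℝ` at bounded horizontal displacement are
related by a bilipschitz map. -/
theorem exists_transport_of_separated {ι P C : Type*} [Fintype ι] [DecidableEq ι] (i₀ : ι)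
    [Fintype C] [Nonempty C] {lo hi ρ D : ℝ} (χ : P → C) (a b : P → (ι → ℝ) × ℝ) (hρ : 0 < ρ)
    (hρh : 2 * ρ ≤ hi - lo) (ha : ∀ p, (a p).2 ∈ Set.Icc (lo + ρ) (hi - ρ))
    (hb : ∀ p, (b p).2 ∈ Set.Icc (lo + ρ) (hi - ρ)) (hD0 : 0 ≤ D)
    (hD : ∀ p, ‖(b p).1 - (a p).1‖ ≤ D)
    (hasep : ∀ p q, p ≠ q → ρ ≤ ‖a p - a q‖) (hbsep : ∀ p q, p ≠ q → ρ ≤ ‖b p - b q‖)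
    (hfar : ∀ p q, p ≠ q → χ p = χ q → 4 * D + 2 * (hi - lo) ≤ ‖(a p).1 - (a q).1‖) :
    ∃ F : (ι → ℝ) × ℝ → (ι → ℝ) × ℝ,
      IsBilipOn (9 * (1 + 24 * (hi - lo) ^ 2 * Fintype.card C / ρ ^ 2) ^ 2 *
        (5 + 16 * (D + ρ / 4) * Fintype.card C / (hi - lo))) F Set.univ ∧
      (∀ p, F (a p) = b p) ∧ ∀ e : (ι → ℝ) × ℝ, e.2 ∉ Set.Ioo lo hi → F e = e := by
  set h := hi - lo with hdef
  have hh : 0 < h := by linarith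
  set N := Fintype.card C with hN
  have hN0 : (1 : ℝ) ≤ N := by exact_mod_cast (Fintype.card_pos : 0 < Fintype.card C)
  have hNpos : (0 : ℝ) < N := by linarith
  set u : ι → ℝ := Pi.single i₀ 1 with hu
  have hu1 : ‖u‖ = 1 := by rw [hu, Pi.norm_single, norm_one]
  have hsu : ∀ t : ℝ, ‖t • u‖ = |t| := fun t => by rw [norm_smul, hu1, mul_one, Real.norm_eq_abs]
  have hu0 : u i₀ = 1 := by simp [hu]
  have hτ : 0 < ρ / 8 := by positivity
  -- Only coordinate `i₀` is perturbed, and only to separate different colours; points of equal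
  -- colour are already far apart by `hfar`.
  have shift := fun x : P → (ι → ℝ) × ℝ =>
    exists_grid_shift hτ (fun p => (x p).1 i₀) (fun p => Fintype.equivFin C (χ p))
  obtain ⟨s, hs, hsk⟩ := shift a
  obtain ⟨s', hs', hsk'⟩ := shift b
  have hcolour : ∀ (x : P → (ι → ℝ) × ℝ) (t : P → ℝ), (∀ p q, Fintype.equivFin C (χ p) ≠
        Fintype.equivFin C (χ q) →
        ρ / 8 / N ≤ |((x p).1 i₀ + t p) - ((x q).1 i₀ + t q)|) → ∀ p q, χ p ≠ χ q →
      ρ / 8 / N ≤ ‖((x p).1 + t p • u) - ((x q).1 + t q • u)‖ := by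
    intro x t hx p q hχ
    refine (hx p q (fun h => hχ ((Fintype.equivFin C).injective h))).trans ?_
    refine le_trans (le_of_eq ?_) (norm_le_pi_norm _ i₀)
    simp [hu0]
  have hρN : ρ / 8 / N ≤ ρ / 8 := div_le_self hτ.le hN0
  have hperturb : ∀ (v w : ι → ℝ) (t t' : ℝ), |t| ≤ ρ / 8 → |t'| ≤ ρ / 8 →
      ‖v - w‖ - ρ / 4 ≤ ‖(v + t • u) - (w + t' • u)‖ := by
    intro v w t t' ht ht'
    have e1 : v - w = ((v + t • u) - (w + t' • u)) - (t • u - t' • u) := by abel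
    have e2 := norm_sub_le ((v + t • u) - (w + t' • u)) (t • u - t' • u)
    rw [← e1] at e2
    have e3 := norm_sub_le (t • u) (t' • u)
    rw [hsu, hsu] at e3
    linarith
  obtain ⟨F₁, hF₁, hF₁a, hF₁id⟩ := exists_horizontal_perturbation u hu1 a s hρ.le hasep ha
    (fun p => (hs p).trans (by linarith))
  -- This undoes the perturbation of the target. Shifts of size ρ/8 cost at most ρ/4 of separation,
  -- leaving 3ρ/4.
  obtain ⟨F₃, hF₃, hF₃a, hF₃id⟩ := exists_horizontal_perturbation (lo := lo) (hi := hi)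
    (ρ := 3 * ρ / 4) u hu1 (fun p => ((b p).1 + s' p • u, (b p).2)) (fun p => - s' p)
    (by positivity) (by
      intro p q hpq
      have h1 := hbsep p q hpq
      rw [Prod.norm_def, le_max_iff] at h1 ⊢
      rcases h1 with h1 | h1
      · left
        have := hperturb (b p).1 (b q).1 _ _ (hs' p) (hs' q)
        simp only [Prod.fst_sub] at h1 ⊢
        linarith
      · right
        simp only [Prod.snd_sub] at h1 ⊢
        linarith) (by
      intro p
      have h1 := hb p
      simp only [Set.mem_Icc] at h1 ⊢
      constructor <;> linarith) (fun p => by rw [abs_neg]; exact (hs' p).trans (by linarith))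
  have hl : 3 ≤ 12 * h * N / ρ := by
    rw [le_div_iff₀ hρ]; nlinarith
  -- The slope l is chosen so that lκ is exactly 3h/2.
  obtain ⟨F₂, hF₂, hF₂a, hF₂id⟩ := exists_transport (lo := lo) (hi := hi) (κ := ρ / 8 / N) (r := ρ)
    (D := D + ρ / 4) (l := 12 * h * N / ρ) (c := ρ / (2 * h)) χ
    (fun p => ((a p).1 + s p • u, (a p).2)) (fun p => ((b p).1 + s' p • u, (b p).2))
    (by linarith) hρ.le ha hb (by positivity) (by
      intro p
      have e1 : (b p).1 + s' p • u - ((a p).1 + s p • u) =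
        ((b p).1 - (a p).1) + (s' p • u - s p • u) := by abel
      have e2 := norm_sub_le (s' p • u) (s p • u)
      rw [hsu, hsu] at e2
      have := hs p
      have := hs' p
      have := hD p
      have e3 := norm_add_le ((b p).1 - (a p).1) (s' p • u - s p • u)
      simp only [e1]
      linarith) (by
      intro p q hpq hχ
      have h1 := hfar p q hpq hχ
      have h2 := hperturb (a p).1 (a q).1 _ _ (hs p) (hs q)
      simp only [← hdef]
      linarith) (by
      intro p q hpq
      by_cases hχ : χ p = χ q
      · have h1 := hfar p q hpq hχ
        have h2 := hperturb (a p).1 (a q).1 _ _ (hs p) (hs q)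
        simp only
        linarith
      · exact hcolour a s hsk p q hχ) (by
      intro p q hpq
      by_cases hχ : χ p = χ q
      · have h1 := hfar p q hpq hχ
        have h2 := hperturb (b p).1 (b q).1 _ _ (hs' p) (hs' q)
        have h3 : ‖(a p).1 - (a q).1‖ ≤ D + ‖(b p).1 - (b q).1‖ + D := by
          have e1 : (a p).1 - (a q).1 =
            -((b p).1 - (a p).1) + ((b p).1 - (b q).1) + ((b q).1 - (a q).1) := by abel
          rw [e1]
          refine (norm_add₃_le).trans ?_
          rw [norm_neg]
          gcongr
          · exact hD p
          · exact hD q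
        simp only
        linarith
      · exact hcolour b s' hsk' p q hχ) hl (by
      rw [← hdef]
      apply le_of_eq
      field_simp
      norm_num) (by
      rw [← hdef, div_mul_cancel₀ _ hρ.ne']
      nlinarith) (by positivity) (by
      rw [div_le_div_iff₀ (by positivity) (by norm_num)]
      linarith) (by
      rw [← hdef]
      have : ρ / (2 * h) * h = ρ / 2 := by field_simp
      linarith)
  have hlc : 12 * h * N / ρ / (ρ / (2 * h)) = 24 * h ^ 2 * N / ρ ^ 2 := by
    field_simp; norm_num
  rw [hlc, ← hdef] at hF₂
  refine ⟨F₃ ∘ (F₂ ∘ F₁), ?_, fun p => ?_, fun e he => ?_⟩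
  · refine (hF₃.comp_univ (by norm_num) (by positivity)
      (hF₂.comp_univ (by positivity) (by norm_num) hF₁)).mono_const (le_of_eq ?_)
    ring
  · simp only [Function.comp]
    rw [hF₁a, hF₂a p, hF₃a p]
    ext <;> simp
  · simp only [Function.comp]
    rw [hF₁id e he, hF₂id e he, hF₃id e he]

/-! ### Maximum norm versus Euclidean norm, lattice points and tiles. -/

/-- The splitting `ℝ^d → ℝ^{d-1} × ℝ`. -/
def splitLast {d : ℕ} (hd : 2 ≤ d) (p : EuclideanSpace ℝ (Fin d)) : (Fin (d - 1) → ℝ) × ℝ :=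
  (fun i => p ⟨i, by omega⟩, p ⟨d - 1, by omega⟩)

theorem layerPoint_splitLast {d : ℕ} (hd : 2 ≤ d) (p : EuclideanSpace ℝ (Fin d)) :
    layerPoint d (splitLast hd p).1 (splitLast hd p).2 = p := by
  ext i
  simp only [layerPoint, splitLast]
  split_ifs with hi
  · rfl
  · have : i = ⟨d - 1, by omega⟩ := Fin.ext (by simp only; omega)
    exact (congrArg (fun j => p j) this).symm

theorem splitLast_layerPoint {d : ℕ} (hd : 2 ≤ d) (x : Fin (d - 1) → ℝ) (h : ℝ) :
    splitLast hd (layerPoint d x h) = (x, h) := by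
  simp [layerPoint, splitLast]

theorem mem_cylinderOver_iff {d : ℕ} (hd : 2 ≤ d) {T : Set ℝ} {p : EuclideanSpace ℝ (Fin d)} :
    p ∈ cylinderOver d T ↔ (splitLast hd p).2 ∈ T := by
  constructor
  · rintro ⟨x, h, hT, rfl⟩
    rwa [splitLast_layerPoint]
  · intro h
    exact ⟨_, _, h, (layerPoint_splitLast hd p).symm⟩

theorem norm_splitLast_sub_le {d : ℕ} (hd : 2 ≤ d) (p q : EuclideanSpace ℝ (Fin d)) :
    ‖splitLast hd p - splitLast hd q‖ ≤ dist p q := by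
  rw [dist_eq_norm, Prod.norm_def, max_le_iff]
  constructor
  · rw [pi_norm_le_iff_of_nonneg (norm_nonneg _)]
    intro i
    exact PiLp.norm_apply_le (p - q) _
  · exact PiLp.norm_apply_le (p - q) _

theorem dist_le_sqrt_mul_norm_splitLast_sub {d : ℕ} (hd : 2 ≤ d)
    (p q : EuclideanSpace ℝ (Fin d)) :
    dist p q ≤ √d * ‖splitLast hd p - splitLast hd q‖ := by
  set m := ‖splitLast hd p - splitLast hd q‖ with hm
  have hm0 : 0 ≤ m := norm_nonneg _
  have hi : ∀ i, dist (p i) (q i) ≤ m := by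
    intro i
    rw [Real.dist_eq, ← Real.norm_eq_abs]
    by_cases hi : (i : ℕ) < d - 1
    · refine le_trans ?_ (norm_fst_le _)
      exact norm_le_pi_norm (splitLast hd p - splitLast hd q).1 ⟨i, hi⟩
    · have : i = ⟨d - 1, by omega⟩ := Fin.ext (by simp only; omega)
      rw [this]
      exact norm_snd_le (splitLast hd p - splitLast hd q)
  rw [EuclideanSpace.dist_eq, ← Real.sqrt_sq hm0, ← Real.sqrt_mul (by positivity)]
  apply Real.sqrt_le_sqrt
  calc ∑ i, dist (p i) (q i) ^ 2 ≤ ∑ _i : Fin d, m ^ 2 := by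
        gcongr with i
        exact hi i
    _ = d * m ^ 2 := by simp

theorem dist_layerPoint_layerPoint {d : ℕ} (hd : 2 ≤ d) (x : Fin (d - 1) → ℝ) (h h' : ℝ) :
    dist (layerPoint d x h) (layerPoint d x h') = |h - h'| := by
  have : layerPoint d x h - layerPoint d x h' =
      EuclideanSpace.single ⟨d - 1, by omega⟩ (h - h') := by
    ext i
    simp only [layerPoint, PiLp.sub_apply, PiLp.single_apply]
    by_cases hi : (i : ℕ) < d - 1
    · have : i ≠ ⟨d - 1, by omega⟩ := fun h0 => by rw [h0] at hi; simp at hi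
      simp [hi, this]
    · have : i = ⟨d - 1, by omega⟩ := Fin.ext (by simp only; omega)
      simp [this]
  rw [dist_eq_norm, this, PiLp.norm_single, Real.norm_eq_abs]

/-- A bilipschitz map for the maximum norm is bilipschitz for the Euclidean norm. -/
theorem IsBilipOn.euclidean {d : ℕ} (hd : 2 ≤ d) {M : ℝ} (hM : 0 ≤ M)
    {F : (Fin (d - 1) → ℝ) × ℝ → (Fin (d - 1) → ℝ) × ℝ} (hF : IsBilipOn M F Set.univ) :
    IsBilipOn (√d * M)
      (fun p => layerPoint d (F (splitLast hd p)).1 (F (splitLast hd p)).2) Set.univ := by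
  intro p _ q _
  obtain ⟨h1, h2⟩ := hF (splitLast hd p) trivial (splitLast hd q) trivial
  rw [dist_eq_norm, dist_eq_norm] at h1 h2
  set p' := layerPoint d (F (splitLast hd p)).1 (F (splitLast hd p)).2 with hp'
  set q' := layerPoint d (F (splitLast hd q)).1 (F (splitLast hd q)).2 with hq'
  have e1 : F (splitLast hd p) = splitLast hd p' := by rw [hp', splitLast_layerPoint]
  have e2 : F (splitLast hd q) = splitLast hd q' := by rw [hq', splitLast_layerPoint]
  rw [e1, e2] at h1 h2
  have hs := Real.sqrt_nonneg d
  constructor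
  · calc dist p' q' ≤ √d * ‖splitLast hd p' - splitLast hd q'‖ :=
          dist_le_sqrt_mul_norm_splitLast_sub hd _ _
      _ ≤ √d * (M * dist p q) := by
          gcongr
          exact h1.trans (by gcongr; exact norm_splitLast_sub_le hd p q)
      _ = _ := by ring
  · calc dist p q ≤ √d * ‖splitLast hd p - splitLast hd q‖ :=
          dist_le_sqrt_mul_norm_splitLast_sub hd _ _
      _ ≤ √d * (M * dist p' q') := by
          gcongr
          exact h2.trans (by gcongr; exact norm_splitLast_sub_le hd _ _)
      _ = _ := by ring

theorem one_le_norm_intCast_sub {ι : Type*} [Fintype ι] {z w : ι → ℤ} (h : z ≠ w) :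
    1 ≤ ‖(fun i => (z i : ℝ)) - fun i => (w i : ℝ)‖ := by
  obtain ⟨i, hi⟩ := Function.ne_iff.1 h
  refine le_trans ?_ (norm_le_pi_norm _ i)
  simp only [Pi.sub_apply, Real.norm_eq_abs]
  exact_mod_cast Int.one_le_abs (sub_ne_zero.2 hi)

theorem le_norm_intCast_sub_of_congr {ι : Type*} [Fintype ι] {K : ℕ} {z w : ι → ℤ} (h : z ≠ w)
    (hK : (fun i => (z i : ZMod K)) = fun i => (w i : ZMod K)) :
    (K : ℝ) ≤ ‖(fun i => (z i : ℝ)) - fun i => (w i : ℝ)‖ := by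
  obtain ⟨i, hi⟩ := Function.ne_iff.1 h
  refine le_trans ?_ (norm_le_pi_norm _ i)
  simp only [Pi.sub_apply, Real.norm_eq_abs]
  have h1 := (ZMod.intCast_eq_intCast_iff_dvd_sub _ _ _).1 (congrFun hK i)
  have h2 := Int.le_of_dvd (abs_pos.2 (sub_ne_zero.2 hi)) ((dvd_abs _ _).2 (dvd_sub_comm.1 h1))
  exact_mod_cast h2

/-- The shift by -1/2 keeps tile boundaries off the lattice, so integer points fall into half-open
blocks of length S. -/
theorem mem_latticeTile_iff {d S : ℕ} {z x : Fin (d - 1) → ℤ} :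
    x ∈ latticeTile d S z ↔ ∀ i, S * z i ≤ x i ∧ x i + 1 ≤ S * z i + S := by
  refine forall_congr' fun i => ?_
  rw [Set.mem_Icc]
  constructor
  · rintro ⟨h1, h2⟩
    constructor
    · have : (S * z i : ℝ) < x i + 1 := by linarith
      exact Int.lt_add_one_iff.1 (by exact_mod_cast this)
    · have : (x i : ℝ) < S * z i + S := by linarith
      have : x i < S * z i + S := by exact_mod_cast this
      linarith
  · rintro ⟨h1, h2⟩
    have h1' : (S * z i : ℝ) ≤ x i := by exact_mod_cast h1
    have h2' : (x i + 1 : ℝ) ≤ S * z i + S := by exact_mod_cast h2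
    constructor <;> linarith

theorem self_mem_latticeTile {d S : ℕ} (hS : 1 ≤ S) (x : Fin (d - 1) → ℤ) :
    x ∈ latticeTile d S (fun i => x i / S) := by
  rw [mem_latticeTile_iff]
  intro i
  have hS' : (0 : ℤ) < S := by exact_mod_cast hS
  have h1 := Int.mul_ediv_add_emod (x i) S
  have h2 := Int.emod_nonneg (x i) hS'.ne'
  have h3 := Int.emod_lt_of_pos (x i) hS'
  constructor <;> linarith

/-! ### Upper bound for β: an exponential member of the family. -/

theorem permutation_constant_le {d S : ℕ} (hd : 2 ≤ d) (hS : 1 ≤ S) :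
    √d * ((1 + 3 / (1 / 4 : ℝ)) ^ 2 * (5 + 16 * S * ((5 * S) ^ (d - 1) : ℕ) / (1 / 2 - -1 / 2))) ≤
      (2 : ℝ) ^ (8 * (d : ℝ) * S) := by
  obtain ⟨n, rfl⟩ : ∃ n, d = n + 1 := ⟨d - 1, by omega⟩
  have hexp : (2 : ℝ) ^ (8 * ((n + 1 : ℕ) : ℝ) * S) = ((2 ^ (8 * (n + 1) * S) : ℕ) : ℝ) := by
    rw [Nat.cast_pow, ← Real.rpow_natCast]
    push_cast
    rfl
  have h5 : ∀ m : ℕ, (m + 1) * 5 ^ m ≤ 2 ^ (4 * m) := by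
    intro m
    induction m with
    | zero => norm_num
    | succ k ih =>
      have : (2 : ℕ) ^ (4 * (k + 1)) = 2 ^ (4 * k) * 16 := by rw [mul_add, pow_add]; norm_num
      rw [this, pow_succ]
      nlinarith [pow_pos (by norm_num : 0 < 5) k, mul_nonneg k.zero_le (5 ^ k).zero_le]
  have hS2 : S ≤ 2 ^ (S - 1) := by
    have := Nat.lt_two_pow_self (n := S - 1)
    omega
  have hSn : S ^ (n + 1) ≤ 2 ^ ((S - 1) * (n + 1)) := by
    rw [pow_mul]
    exact Nat.pow_le_pow_left hS2 _
  have hnat : (n + 1) * (169 * (21 * (S * (5 * S) ^ n))) ≤ 2 ^ (8 * (n + 1) * S) := by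
    calc (n + 1) * (169 * (21 * (S * (5 * S) ^ n)))
        = 3549 * (((n + 1) * 5 ^ n) * S ^ (n + 1)) := by rw [mul_pow, pow_succ]; ring
      _ ≤ 2 ^ 12 * (2 ^ (4 * n) * 2 ^ ((S - 1) * (n + 1))) := by
          gcongr
          · norm_num
          · exact h5 n
      _ = 2 ^ (12 + (4 * n + (S - 1) * (n + 1))) := by rw [pow_add, pow_add]
      _ ≤ 2 ^ (8 * (n + 1) * S) := by
          apply Nat.pow_le_pow_right (by norm_num)
          obtain ⟨T, rfl⟩ : ∃ T, S = T + 1 := ⟨S - 1, by omega⟩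
          have hn : 1 ≤ n := by omega
          simp only [Nat.add_sub_cancel]
          nlinarith [mul_nonneg T.zero_le n.zero_le]
  have hsqrt : √((n + 1 : ℕ) : ℝ) ≤ ((n + 1 : ℕ) : ℝ) := by
    rw [Real.sqrt_le_left (by positivity)]
    have : (1 : ℝ) ≤ ((n + 1 : ℕ) : ℝ) := by exact_mod_cast Nat.succ_pos n
    nlinarith
  have hone : (1 : ℝ) ≤ S * ((5 * S) ^ n : ℕ) := by
    have : 1 ≤ S * (5 * S) ^ n := Nat.one_le_iff_ne_zero.2 (by positivity)
    exact_mod_cast this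
  rw [hexp]
  refine le_trans ?_ (Nat.cast_le.2 hnat)
  rw [Nat.add_sub_cancel, Nat.cast_mul (n + 1)]
  gcongr
  rw [Nat.cast_mul, Nat.cast_mul 21, Nat.cast_mul S]
  norm_num at hone ⊢
  linarith

/-- Transport in the slab of height 1: tiles bound displacements by D = S, and residues mod 5S serve
as colours because 4S + 1 ≤ 5S. Lattice projections are 1-separated, so no perturbation is needed.
-/
theorem exists_permutation_map {d S : ℕ} (hd : 2 ≤ d) (hS : 1 ≤ S)
    (σ : Equiv.Perm (Fin (d - 1) → ℤ))
    (hσ : ∀ z : Fin (d - 1) → ℤ, Set.BijOn σ (latticeTile d S z) (latticeTile d S z)) :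
    ∃ Υ : EuclideanSpace ℝ (Fin d) → EuclideanSpace ℝ (Fin d),
      IsBilipOn ((2 : ℝ) ^ (8 * (d : ℝ) * S)) Υ Set.univ ∧
      (∀ p ∈ cylinderOver d {h : ℝ | h ∉ Set.Ioo (-1 / 2 : ℝ) (1 / 2)}, Υ p = p) ∧
      ∀ x : Fin (d - 1) → ℤ, Υ (latticePoint d x 0) = latticePoint d (σ x) 0 := by
  have : NeZero (5 * S) := ⟨by omega⟩
  have hS' : (1 : ℝ) ≤ S := by exact_mod_cast hS
  obtain ⟨F, hF, hFa, hFid⟩ := exists_transport (lo := -1 / 2) (hi := 1 / 2) (κ := 1) (r := 1 / 2)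
    (D := S) (l := 3) (c := 1 / 4) (X := Fin (d - 1) → ℝ)
    (fun (z : Fin (d - 1) → ℤ) i => (z i : ZMod (5 * S)))
    (fun z => (fun i => (z i : ℝ), 0)) (fun z => (fun i => (σ z i : ℝ), 0)) (by norm_num)
    (by norm_num) (fun _ => by norm_num) (fun _ => by norm_num) (by positivity) (by
      intro z
      rw [pi_norm_le_iff_of_nonneg (by positivity)]
      intro i
      have h1 := self_mem_latticeTile hS z
      have h2 := mem_latticeTile_iff.1 ((hσ _).mapsTo h1) i
      have h3 := mem_latticeTile_iff.1 h1 i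
      simp only [Pi.sub_apply, Real.norm_eq_abs]
      have : |σ z i - z i| ≤ S := by
        rw [abs_le]; constructor <;> linarith
      exact_mod_cast this) (by
      intro z w hzw hχ
      refine le_trans ?_ (le_norm_intCast_sub_of_congr hzw hχ)
      push_cast
      linarith) (fun z w hzw => one_le_norm_intCast_sub hzw)
    (fun z w hzw => one_le_norm_intCast_sub (σ.injective.ne hzw)) (by norm_num) (by norm_num)
    (by norm_num) (by norm_num) (by norm_num) (by norm_num)
  have hcard : Fintype.card (Fin (d - 1) → ZMod (5 * S)) = (5 * S) ^ (d - 1) := by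
    rw [Fintype.card_fun, ZMod.card, Fintype.card_fin]
  rw [hcard] at hF
  refine ⟨_, (hF.euclidean hd ?_).mono_const (permutation_constant_le hd hS), fun p hp => ?_,
    fun x => ?_⟩
  · norm_num; positivity
  · rw [hFid _ ((mem_cylinderOver_iff hd).1 hp), layerPoint_splitLast]
  · simp only [latticePoint]
    rw [splitLast_layerPoint, hFa x]

theorem exp_mem_permutationFamily {d : ℕ} (hd : 2 ≤ d) :
    (fun t : ℝ => (2 : ℝ) ^ (8 * (d : ℝ) * t)) ∈ permutationFamily d := by
  refine ⟨fun t ht => ?_, fun s _ t _ hst => ?_, fun S hS σ hσ => exists_permutation_map hd hS σ hσ⟩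
  · have ht' : (1 : ℝ) ≤ t := ht
    exact Real.one_le_rpow (by norm_num) (by positivity)
  · exact Real.rpow_le_rpow_of_exponent_le (by norm_num) (by gcongr)

/-! ### Lower bound for β: tile reversal. -/

/-- The permutation reversing every coordinate inside every tile of side `S`. -/
def tileReversal (ι : Type*) {S : ℕ} (hS : 1 ≤ S) : Equiv.Perm (ι → ℤ) :=
  Function.Involutive.toPerm (fun x i => 2 * (S * (x i / S)) + S - 1 - x i) (by
    intro x
    ext i
    have hS' : (0 : ℤ) < S := by exact_mod_cast hS
    have h1 := Int.mul_ediv_add_emod (x i) S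
    have h2 := Int.emod_nonneg (x i) hS'.ne'
    have h3 := Int.emod_lt_of_pos (x i) hS'
    have : (2 * (S * (x i / S)) + S - 1 - x i) / S = x i / S := by
      rw [Int.ediv_eq_iff_of_pos hS']
      constructor <;> nlinarith
    simp only [this]
    ring)

theorem tileReversal_apply {ι : Type*} {S : ℕ} (hS : 1 ≤ S) (x : ι → ℤ) (i : ι) :
    tileReversal ι hS x i = 2 * (S * (x i / S)) + S - 1 - x i := rfl

theorem bijOn_tileReversal {d S : ℕ} (hS : 1 ≤ S) (z : Fin (d - 1) → ℤ) :
    Set.BijOn (tileReversal (Fin (d - 1)) hS) (latticeTile d S z) (latticeTile d S z) := by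
  have hmaps : Set.MapsTo (tileReversal (Fin (d - 1)) hS) (latticeTile d S z)
      (latticeTile d S z) := by
    intro x hx
    rw [mem_latticeTile_iff] at hx ⊢
    intro i
    have hS' : (0 : ℤ) < S := by exact_mod_cast hS
    have h1 := hx i
    have : x i / S = z i := by
      rw [Int.ediv_eq_iff_of_pos hS']
      constructor <;> linarith
    rw [tileReversal_apply, this]
    constructor <;> linarith
  refine ⟨hmaps, (tileReversal _ hS).injective.injOn, fun x hx => ⟨_, hmaps hx, ?_⟩⟩
  exact Function.Involutive.toPerm_involutive _ x

theorem le_of_mem_permutationFamily {d : ℕ} (hd : 2 ≤ d) {ψ : ℝ → ℝ}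
    (hψ : ψ ∈ permutationFamily d) {t : ℝ} (ht : 1 ≤ t) : 2 * (⌊t⌋ : ℝ) - 1 ≤ ψ t := by
  obtain ⟨-, hmono, hmap⟩ := hψ
  have hfl : (1 : ℤ) ≤ ⌊t⌋ := Int.le_floor.2 (by exact_mod_cast ht)
  obtain ⟨S, hS⟩ : ∃ S : ℕ, ⌊t⌋ = S := ⟨_, (Int.toNat_of_nonneg (by omega)).symm⟩
  have hS1 : 1 ≤ S := by omega
  have hS1' : (1 : ℝ) ≤ S := by exact_mod_cast hS1
  have hSt : (S : ℝ) ≤ t := by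
    have := Int.floor_le t
    rw [hS] at this
    exact_mod_cast this
  rw [hS]
  refine le_trans ?_ (hmono hS1' ht hSt)
  obtain ⟨Υ, hΥ, -, hΥσ⟩ := hmap S hS1 (tileReversal _ hS1) (bijOn_tileReversal hS1)
  let i₀ : Fin (d - 1) := ⟨0, by omega⟩
  -- Neighbours on either side of a tile boundary; reversal sends their coordinates S - 1 and S to 0
  -- and 2S - 1.
  let x : Fin (d - 1) → ℤ := Pi.single i₀ ((S : ℤ) - 1)
  let y : Fin (d - 1) → ℤ := Pi.single i₀ (S : ℤ)
  have hS' : (0 : ℤ) < S := by exact_mod_cast hS1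
  have hx : tileReversal _ hS1 x i₀ = 0 := by
    have : ((S : ℤ) - 1) / S = 0 := Int.ediv_eq_zero_of_lt (by omega) (by omega)
    rw [tileReversal_apply]
    simp [x, this]
  have hy : tileReversal _ hS1 y i₀ = 2 * S - 1 := by
    rw [tileReversal_apply]
    simp only [y, Pi.single_eq_same, Int.ediv_self hS'.ne']
    ring
  have hdist : dist (latticePoint d x 0) (latticePoint d y 0) ≤ 1 := by
    have : latticePoint d y 0 - latticePoint d x 0 =
        EuclideanSpace.single ⟨0, by omega⟩ (1 : ℝ) := by
      ext i
      simp only [latticePoint, layerPoint, PiLp.sub_apply, PiLp.single_apply, x, y, i₀]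
      by_cases hi : (i : ℕ) < d - 1
      · by_cases h0 : i = ⟨0, by omega⟩
        · have hv : (i : ℕ) = 0 := by rw [h0]
          have h0' : (⟨i, hi⟩ : Fin (d - 1)) = ⟨0, by omega⟩ := Fin.ext hv
          simp only [dif_pos hi, h0', if_pos h0, Pi.single_eq_same]
          push_cast
          ring
        · have h0' : (⟨i, hi⟩ : Fin (d - 1)) ≠ ⟨0, by omega⟩ := fun h => h0 (Fin.ext (by
            simpa using h))
          simp [hi, h0, h0']
      · have h0 : i ≠ ⟨0, by omega⟩ := fun h => by rw [h] at hi; simp at hi; omega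
        simp [hi, h0]
    rw [dist_comm, dist_eq_norm, this]
    simp
  have h1 := (hΥ (latticePoint d x 0) trivial (latticePoint d y 0) trivial).1
  have hψ0 : 0 ≤ ψ S := by
    by_contra hneg
    have h2 := dist_nonneg.trans h1
    have h3 : 0 < dist (latticePoint d x 0) (latticePoint d y 0) := by
      rw [dist_pos]
      intro h
      have := congrArg (fun p => (splitLast hd p).1 i₀) h
      simp only [latticePoint, splitLast_layerPoint, x, y, Pi.single_eq_same] at this
      push_cast at this
      linarith
    nlinarith
  rw [hΥσ, hΥσ] at h1
  have h2 := norm_splitLast_sub_le hd (latticePoint d (tileReversal _ hS1 x) 0)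
    (latticePoint d (tileReversal _ hS1 y) 0)
  have h3 := (norm_fst_le _).trans h2
  simp only [latticePoint, splitLast_layerPoint, Prod.fst_sub] at h3
  have h4 := (norm_le_pi_norm _ i₀).trans h3
  simp only [Pi.sub_apply, hx, hy] at h4
  rw [Real.norm_eq_abs, abs_sub_comm] at h4
  have h5 := (le_abs_self _).trans h4
  push_cast at h5 ⊢
  have h6 : ψ S * dist (latticePoint d x 0) (latticePoint d y 0) ≤ ψ S :=
    mul_le_of_le_one_right hψ0 hdist
  simp only [latticePoint] at h6 h1
  linarith

/-! ### The extension and its constant. -/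

theorem extension_constant_le {d H K : ℕ} {L β : ℝ} (hd : 2 ≤ d) (hH : 1 ≤ H) (hL : 1 ≤ L)
    (hK : (K : ℝ) ≤ 7 * L * H) (hK1 : 1 ≤ K)
    (hβ : (2 : ℝ) ^ 42 * L ^ 10 * (H : ℝ) ^ 3 ≤ β) :
    √d * (9 * (1 + 24 * (H : ℝ) ^ 2 * (K ^ (d - 1) * H : ℕ) / (1 / (2 * L * √d)) ^ 2) ^ 2 *
        (5 + 16 * (L * H + 1 / (2 * L * √d) / 4) * (K ^ (d - 1) * H : ℕ) / H)) ≤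
      (2 : ℝ) ^ 38 * (d : ℝ) ^ (9 / 2 : ℝ) * L ^ 9 * (H : ℝ) ^ (2 + 3 / ((d : ℝ) - 1)) *
        β ^ (3 ^ (d - 1)) := by
  have hd' : (2 : ℝ) ≤ d := by exact_mod_cast hd
  have hH' : (1 : ℝ) ≤ H := by exact_mod_cast hH
  have hK' : (1 : ℝ) ≤ K := by exact_mod_cast hK1
  obtain ⟨n, hn⟩ : ∃ n, d = n + 1 := ⟨d - 1, by omega⟩
  have hdn : d - 1 = n := by omega
  have hn1 : 1 ≤ n := by omega
  rw [hdn]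
  set x : ℝ := (H : ℝ) with hx
  set N : ℝ := ((K ^ n * H : ℕ) : ℝ) with hN
  have hNeq : N = (K : ℝ) ^ n * x := by rw [hN]; push_cast; rfl
  have hN1 : 1 ≤ N := by
    rw [hNeq]
    exact one_le_mul_of_one_le_of_one_le (one_le_pow₀ hK') hH'
  have hNle : N ≤ (7 * L * x) ^ n * x := by rw [hNeq]; gcongr
  set s := √(d : ℝ) with hs
  have hs1 : 1 ≤ s := Real.one_le_sqrt.2 (by linarith)
  have hLs : 1 ≤ L * s := one_le_mul_of_one_le_of_one_le hL hs1
  have hA : 1 + 24 * x ^ 2 * N / (1 / (2 * L * s)) ^ 2 ≤ 97 * (L * s) ^ 2 * x ^ 2 * N := by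
    have e : 24 * x ^ 2 * N / (1 / (2 * L * s)) ^ 2 = 96 * ((L * s) ^ 2 * x ^ 2 * N) := by
      field_simp; ring
    have : 1 ≤ (L * s) ^ 2 * x ^ 2 * N :=
      one_le_mul_of_one_le_of_one_le
        (one_le_mul_of_one_le_of_one_le (one_le_pow₀ hLs) (one_le_pow₀ hH')) hN1
    rw [e]
    linarith
  have hB : 5 + 16 * (L * x + 1 / (2 * L * s) / 4) * N / x ≤ 37 * L * N := by
    have e1 : 1 / (2 * L * s) / 4 ≤ L * x := by
      have : 1 / (2 * L * s) ≤ 1 := by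
        rw [div_le_one (by positivity)]; nlinarith
      nlinarith
    have e2 : 16 * (L * x + 1 / (2 * L * s) / 4) * N / x ≤ 16 * (L * x + L * x) * N / x := by
      gcongr
    have e3 : 16 * (L * x + L * x) * N / x = 32 * (L * N) := by field_simp; ring
    have : 1 ≤ L * N := one_le_mul_of_one_le_of_one_le hL hN1
    linarith
  have hdpow : (d : ℝ) ^ (9 / 2 : ℝ) = s ^ 9 := by
    rw [hs, Real.sqrt_eq_rpow, ← Real.rpow_natCast, ← Real.rpow_mul (by positivity)]
    norm_num
  have hHpow : x ^ 2 ≤ x ^ (2 + 3 / ((d : ℝ) - 1)) := by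
    rw [← Real.rpow_natCast]
    apply Real.rpow_le_rpow_of_exponent_le hH'
    have : 0 ≤ 3 / ((d : ℝ) - 1) := div_nonneg (by norm_num) (by linarith)
    push_cast
    linarith
  -- The factor N³ grows like (LH)^{3n}, with n = d - 1; it fits under β^{3^n} because 3n ≤ 3^n and
  -- β dominates a large power of L and H.
  have hN3 : x ^ 2 * N ^ 3 ≤ β ^ (3 ^ n) := by
    set T : ℝ := (2 : ℝ) ^ 42 * L ^ 10 * x ^ 3 with hT
    have hT1 : 1 ≤ T := one_le_mul_of_one_le_of_one_le
      (one_le_mul_of_one_le_of_one_le (by norm_num) (one_le_pow₀ hL)) (one_le_pow₀ hH')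
    have h3n : 3 * n ≤ 3 ^ n := by
      obtain ⟨m, rfl⟩ : ∃ m, n = m + 1 := ⟨n - 1, by omega⟩
      have := Nat.lt_pow_self (n := m) (by norm_num : 1 < 3)
      rw [pow_succ]
      omega
    calc x ^ 2 * N ^ 3 ≤ x ^ 2 * ((7 * L * x) ^ n * x) ^ 3 := by gcongr
      _ = x ^ 5 * (7 * L * x) ^ (3 * n) := by ring
      _ ≤ x ^ (5 * n) * (7 * L * x) ^ (3 * n) := by
          gcongr ?_ * _
          exact pow_le_pow_right₀ hH' (by omega)
      _ = (x ^ 5 * (7 * L * x) ^ 3) ^ n := by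
          rw [mul_pow (x ^ 5), ← pow_mul x, ← pow_mul (7 * L * x)]
      _ ≤ (T ^ 3) ^ n := by
          gcongr
          have e1 : x ^ 5 * (7 * L * x) ^ 3 = 343 * L ^ 3 * x ^ 8 := by ring
          have e2 : T ^ 3 = (2 ^ 42) ^ 3 * L ^ 30 * x ^ 9 := by rw [hT]; ring
          rw [e1, e2]
          gcongr
          all_goals first | assumption | norm_num
      _ = T ^ (3 * n) := by rw [← pow_mul]
      _ ≤ T ^ (3 ^ n) := pow_le_pow_right₀ hT1 h3n
      _ ≤ β ^ (3 ^ n) := by gcongr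
  have hβ0 : 0 ≤ β := le_trans (by positivity) hβ
  calc s * (9 * (1 + 24 * x ^ 2 * N / (1 / (2 * L * s)) ^ 2) ^ 2 *
        (5 + 16 * (L * x + 1 / (2 * L * s) / 4) * N / x))
      ≤ s * (9 * (97 * (L * s) ^ 2 * x ^ 2 * N) ^ 2 * (37 * L * N)) := by gcongr
    _ = (9 * 97 ^ 2 * 37) * s ^ 5 * L ^ 5 * x ^ 2 * (x ^ 2 * N ^ 3) := by ring
    _ ≤ (2 : ℝ) ^ 38 * s ^ 9 * L ^ 9 * x ^ (2 + 3 / ((d : ℝ) - 1)) * β ^ (3 ^ n) := by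
        gcongr
        all_goals first | assumption | norm_num
    _ = _ := by rw [hdpow]

theorem exists_bilipschitz_extension {d H : ℕ} {L β : ℝ} (hd : 2 ≤ d)
    {f : EuclideanSpace ℝ (Fin d) → EuclideanSpace ℝ (Fin d)} (hH : 1 ≤ H) (hL : 1 ≤ L)
    (hf : IsBilipOn L f (cylinderOver d {1 / 2, (H : ℝ) + 1 / 2} ∪ latticeLayers d H))
    (hfid : ∀ p ∈ cylinderOver d {1 / 2, (H : ℝ) + 1 / 2}, f p = p)
    (hfmaps : Set.MapsTo f (latticeLayers d H)
      (cylinderOver d (Set.Icc (1 / 2) ((H : ℝ) + 1 / 2))))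
    (hβ : (2 : ℝ) ^ 42 * L ^ 10 * (H : ℝ) ^ 3 ≤ β) :
    ∃ F : EuclideanSpace ℝ (Fin d) → EuclideanSpace ℝ (Fin d),
      Set.EqOn F f (cylinderOver d {1 / 2, (H : ℝ) + 1 / 2} ∪ latticeLayers d H) ∧
      IsBilipOn ((2 : ℝ) ^ 38 * (d : ℝ) ^ (9 / 2 : ℝ) * L ^ 9 *
        (H : ℝ) ^ (2 + 3 / ((d : ℝ) - 1)) * β ^ (3 ^ (d - 1))) F Set.univ := by
  have hd' : (2 : ℝ) ≤ d := by exact_mod_cast hd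
  have hH' : (1 : ℝ) ≤ H := by exact_mod_cast hH
  have hs1 : 1 ≤ √(d : ℝ) := Real.one_le_sqrt.2 (by linarith)
  have hLs : 1 ≤ L * √(d : ℝ) := one_le_mul_of_one_le_of_one_le hL hs1
  have hLH : 1 ≤ L * H := one_le_mul_of_one_le_of_one_le hL hH'
  -- Images of lattice points are 1/(L√d)-separated in the maximum norm and at least 1/(2L) from the
  -- two fixed planes; ρ lies below both.
  set ρ : ℝ := 1 / (2 * L * √d) with hρ
  have hρ0 : 0 < ρ := by positivity
  have hρ2 : ρ ≤ 1 / (2 * L) := by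
    rw [hρ]
    apply one_div_le_one_div_of_le (by positivity)
    nlinarith
  have hρ1 : ρ ≤ 1 / 2 := by
    refine hρ2.trans ?_
    apply one_div_le_one_div_of_le (by positivity)
    linarith
  -- With D = LH and slab height H, the distance required within a colour is 4LH + 2H ≤ 6LH.
  set K := ⌈6 * L * H⌉₊ with hK
  have hK6 : 6 * L * H ≤ K := Nat.le_ceil _
  have hK7 : (K : ℝ) ≤ 7 * L * H := by
    have := (Nat.ceil_lt_add_one (by positivity : 0 ≤ 6 * L * H)).le
    linarith
  have hK1 : 1 ≤ K := by
    have : (1 : ℝ) ≤ K := by linarith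
    exact_mod_cast this
  have : NeZero K := ⟨by omega⟩
  have : NeZero H := ⟨by omega⟩
  let P := (Fin (d - 1) → ℤ) × Fin H
  let e : P → EuclideanSpace ℝ (Fin d) := fun p => latticePoint d p.1 ((p.2 : ℕ) + 1 : ℕ)
  have hmem : ∀ p, e p ∈ latticeLayers d H := fun p =>
    ⟨p.1, _, by omega, by have := p.2.2; omega, rfl⟩
  have hsplit : ∀ p, splitLast hd (e p) = (fun i => (p.1 i : ℝ), (((p.2 : ℕ) + 1 : ℕ) : ℝ)) :=
    fun p => splitLast_layerPoint hd _ _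
  have hplane : ∀ (x : Fin (d - 1) → ℝ) (y : ℝ), y ∈ ({1 / 2, (H : ℝ) + 1 / 2} : Set ℝ) →
      layerPoint d x y ∈ cylinderOver d {1 / 2, (H : ℝ) + 1 / 2} := fun x y hy => ⟨x, y, hy, rfl⟩
  have hheight : ∀ p : P, (1 : ℝ) ≤ ((p.2 : ℕ) + 1 : ℕ) ∧ (((p.2 : ℕ) + 1 : ℕ) : ℝ) ≤ H := by
    intro p
    have := p.2.2
    constructor
    · exact_mod_cast Nat.succ_pos _
    · exact_mod_cast this
  have hasep : ∀ p q : P, p ≠ q → 1 ≤ ‖splitLast hd (e p) - splitLast hd (e q)‖ := by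
    rintro ⟨z, j⟩ ⟨w, k⟩ hpq
    rw [hsplit, hsplit]
    by_cases hzw : z = w
    · have hjk : ((j : ℕ) : ℤ) - (k : ℕ) ≠ 0 := by
        intro h0
        have : (j : ℕ) = k := by omega
        exact hpq (Prod.ext hzw (Fin.ext this))
      refine le_trans ?_ (norm_snd_le _)
      simp only [Prod.snd_sub, Nat.cast_add, Nat.cast_one, add_sub_add_right_eq_sub,
        Real.norm_eq_abs]
      exact_mod_cast Int.one_le_abs hjk
    · refine le_trans ?_ (norm_fst_le _)
      exact one_le_norm_intCast_sub hzw
  -- the images stay away from the two planes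
  have haway : ∀ (p : P) (y : ℝ), y ∈ ({1 / 2, (H : ℝ) + 1 / 2} : Set ℝ) →
      1 / 2 ≤ |(((p.2 : ℕ) + 1 : ℕ) : ℝ) - y| → ρ ≤ |(splitLast hd (f (e p))).2 - y| := by
    intro p y hy hpy
    have hq := hplane (splitLast hd (f (e p))).1 y hy
    have h1 := (hf (e p) (Or.inr (hmem p)) _ (Or.inl hq)).2
    rw [hfid _ hq] at h1
    have h3 := dist_layerPoint_layerPoint hd (splitLast hd (f (e p))).1
      (splitLast hd (f (e p))).2 y
    rw [layerPoint_splitLast] at h3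
    rw [h3] at h1
    have h2 := (norm_snd_le _).trans (norm_splitLast_sub_le hd (e p)
      (layerPoint d (splitLast hd (f (e p))).1 y))
    rw [hsplit, splitLast_layerPoint] at h2
    simp only [Prod.snd_sub, Real.norm_eq_abs] at h2
    refine hρ2.trans ?_
    rw [div_le_iff₀ (by positivity)]
    linarith
  obtain ⟨F, hF, hFa, hFout⟩ := exists_transport_of_separated (lo := 1 / 2)
    (hi := (H : ℝ) + 1 / 2) (ρ := ρ) (D := L * H) (⟨0, by omega⟩ : Fin (d - 1))
    (C := (Fin (d - 1) → ZMod K) × Fin H) (P := P)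
    (fun p => ((fun i => (p.1 i : ZMod K)), p.2))
    (fun p => splitLast hd (e p)) (fun p => splitLast hd (f (e p))) hρ0 (by linarith) (by
      intro p
      have := hheight p
      rw [hsplit, Set.mem_Icc]
      constructor <;> linarith) (by
      intro p
      have h0 := hheight p
      have h1 := (mem_cylinderOver_iff hd).1 (hfmaps (hmem p))
      have h2 := haway p (1 / 2) (by simp) (by
        rw [abs_of_nonneg (by linarith)]; linarith)
      have h3 := haway p ((H : ℝ) + 1 / 2) (by simp) (by
        rw [abs_of_nonpos (by linarith)]; linarith)
      rw [Set.mem_Icc] at h1 ⊢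
      rw [abs_of_nonneg (by linarith)] at h2
      rw [abs_of_nonpos (by linarith)] at h3
      constructor <;> linarith) (by positivity) (by
      intro p
      have h0 := hheight p
      -- The point of the lower plane beneath `e p` is fixed and at distance at most H, so the
      -- horizontal displacement is at most LH.
      have hq := hplane (fun i => (p.1 i : ℝ)) (1 / 2) (by simp)
      have h1 := (hf (e p) (Or.inr (hmem p)) _ (Or.inl hq)).1
      rw [hfid _ hq] at h1
      have h2 : dist (e p) (layerPoint d (fun i => (p.1 i : ℝ)) (1 / 2)) ≤ H := by
        simp only [e, latticePoint]
        rw [dist_layerPoint_layerPoint hd, abs_of_nonneg (by linarith)]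
        linarith
      have h3 := (norm_fst_le _).trans (norm_splitLast_sub_le hd (f (e p))
        (layerPoint d (fun i => (p.1 i : ℝ)) (1 / 2)))
      rw [splitLast_layerPoint] at h3
      rw [hsplit]
      exact h3.trans (h1.trans (by gcongr)))
    (fun p q hpq => le_trans (by linarith) (hasep p q hpq)) (by
      intro p q hpq
      have h1 := (hasep p q hpq).trans (norm_splitLast_sub_le hd _ _)
      have h2 := (hf _ (Or.inr (hmem p)) _ (Or.inr (hmem q))).2
      have h3 := dist_le_sqrt_mul_norm_splitLast_sub hd (f (e p)) (f (e q))
      have h4 : 1 ≤ L * (√d * ‖splitLast hd (f (e p)) - splitLast hd (f (e q))‖) :=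
        h1.trans (h2.trans (by gcongr))
      rw [hρ, div_le_iff₀ (by positivity)]
      linarith) (by
      rintro ⟨z, j⟩ ⟨w, k⟩ hpq hχ
      simp only [Prod.mk.injEq] at hχ
      have hzw : z ≠ w := fun h => hpq (Prod.ext h hχ.2)
      have := le_norm_intCast_sub_of_congr hzw hχ.1
      rw [hsplit, hsplit]
      refine le_trans ?_ this
      nlinarith)
  have hcard : Fintype.card ((Fin (d - 1) → ZMod K) × Fin H) = K ^ (d - 1) * H := by
    rw [Fintype.card_prod, Fintype.card_fun, ZMod.card, Fintype.card_fin, Fintype.card_fin]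
  rw [hcard, add_sub_cancel_right] at hF
  refine ⟨fun p => layerPoint d (F (splitLast hd p)).1 (F (splitLast hd p)).2, ?_,
    (hF.euclidean hd (by positivity)).mono_const (extension_constant_le hd hH hL hK7 hK1 hβ)⟩
  rintro p (hp | ⟨z, m, hm1, hmH, rfl⟩)
  · have hp2 := (mem_cylinderOver_iff hd).1 hp
    simp only
    rw [hFout, layerPoint_splitLast, hfid p hp]
    rintro ⟨h1, h2⟩
    rcases hp2 with h | h
    · exact h1.ne' h
    · exact h2.ne h
  · have : latticePoint d z (m : ℝ) = e (z, ⟨m - 1, by omega⟩) := by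
      simp only [e]
      congr 2
      omega
    simp only
    rw [this, hFa, layerPoint_splitLast]

/-! ### Assembly. -/

/-- Here `β` is a function of `d` only; it is the pointwise infimum of `permutationFamily d`. -/
theorem mainTheorem3 (d : ℕ) (hd : 2 ≤ d) :
    ∃ β : ℝ → ℝ,
      Set.MapsTo β (Set.Ici 1) (Set.Ici 1) ∧
      MonotoneOn β (Set.Ici 1) ∧
      (∀ t : ℝ, 1 ≤ t →
        2 * (⌊t⌋ : ℝ) - 1 ≤ β t ∧ β t ≤ (2 : ℝ) ^ (8 * (d : ℝ) * t)) ∧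
      (∀ t : ℝ, 1 ≤ t → IsGLB {s : ℝ | ∃ ψ ∈ permutationFamily d, s = ψ t} (β t)) ∧
      ∀ (H : ℕ) (L : ℝ) (f : EuclideanSpace ℝ (Fin d) → EuclideanSpace ℝ (Fin d)),
        1 ≤ H → 1 ≤ L →
        IsBilipOn L f (cylinderOver d {1 / 2, (H : ℝ) + 1 / 2} ∪ latticeLayers d H) →
        (∀ p ∈ cylinderOver d {1 / 2, (H : ℝ) + 1 / 2}, f p = p) →
        Set.MapsTo f (latticeLayers d H) (cylinderOver d (Set.Icc (1 / 2) ((H : ℝ) + 1 / 2))) →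
        ∃ F : EuclideanSpace ℝ (Fin d) → EuclideanSpace ℝ (Fin d),
          Set.EqOn F f (cylinderOver d {1 / 2, (H : ℝ) + 1 / 2} ∪ latticeLayers d H) ∧
          IsBilipOn
            ((2 : ℝ) ^ 38 * (d : ℝ) ^ (9 / 2 : ℝ) * L ^ 9 *
                (H : ℝ) ^ (2 + 3 / ((d : ℝ) - 1)) *
              β ((2 : ℝ) ^ 42 * (d : ℝ) ^ (9 / 2 : ℝ) * L ^ 10 *
                (H : ℝ) ^ (3 + 3 / ((d : ℝ) - 1))) ^ (3 ^ (d - 1)))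
            F Set.univ := by
  have hglb : ∀ t : ℝ, 1 ≤ t → IsGLB {s : ℝ | ∃ ψ ∈ permutationFamily d, s = ψ t}
      (sInf {s : ℝ | ∃ ψ ∈ permutationFamily d, s = ψ t}) := by
    intro t ht
    refine isGLB_csInf ⟨_, _, exp_mem_permutationFamily hd, rfl⟩ ⟨1, ?_⟩
    rintro _ ⟨ψ, hψ, rfl⟩
    exact hψ.1 ht
  have hlower : ∀ t : ℝ, 1 ≤ t →
      2 * (⌊t⌋ : ℝ) - 1 ≤ sInf {s : ℝ | ∃ ψ ∈ permutationFamily d, s = ψ t} := by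
    intro t ht
    refine (hglb t ht).2 ?_
    rintro _ ⟨ψ, hψ, rfl⟩
    exact le_of_mem_permutationFamily hd hψ ht
  refine ⟨fun t => sInf {s : ℝ | ∃ ψ ∈ permutationFamily d, s = ψ t}, ?_, ?_, ?_, hglb, ?_⟩
  · intro t ht
    refine (hglb t ht).2 ?_
    rintro _ ⟨ψ, hψ, rfl⟩
    exact hψ.1 ht
  · intro s hs t ht hst
    refine (hglb t ht).2 ?_
    rintro _ ⟨ψ, hψ, rfl⟩
    exact ((hglb s hs).1 ⟨ψ, hψ, rfl⟩).trans (hψ.2.1 hs ht hst)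
  · exact fun t ht => ⟨hlower t ht, (hglb t ht).1 ⟨_, exp_mem_permutationFamily hd, rfl⟩⟩
  · intro H L f hH hL hf hfid hfmaps
    refine exists_bilipschitz_extension hd hH hL hf hfid hfmaps ?_
    have hd' : (2 : ℝ) ≤ d := by exact_mod_cast hd
    have hH' : (1 : ℝ) ≤ H := by exact_mod_cast hH
    set T : ℝ := (2 : ℝ) ^ 42 * (d : ℝ) ^ (9 / 2 : ℝ) * L ^ 10 *
      (H : ℝ) ^ (3 + 3 / ((d : ℝ) - 1)) with hT
    have hH3 : (H : ℝ) ^ 3 ≤ (H : ℝ) ^ (3 + 3 / ((d : ℝ) - 1)) := by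
      rw [← Real.rpow_natCast]
      apply Real.rpow_le_rpow_of_exponent_le hH'
      have : 0 ≤ 3 / ((d : ℝ) - 1) := div_nonneg (by norm_num) (by linarith)
      push_cast
      linarith
    have hd1 : 1 ≤ (d : ℝ) ^ (9 / 2 : ℝ) := Real.one_le_rpow (by linarith) (by norm_num)
    have hT1 : (2 : ℝ) ^ 42 * L ^ 10 * (H : ℝ) ^ 3 ≤ T := by
      rw [hT]
      gcongr
      exact le_mul_of_one_le_right (by norm_num) hd1
    -- From T ≥ 3 follows 2⌊T⌋ - 1 > 2T - 3 ≥ T, so β(T) dominates its argument.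
    have hT3 : 3 ≤ T := by
      refine le_trans ?_ hT1
      have : 1 ≤ L ^ 10 * (H : ℝ) ^ 3 :=
        one_le_mul_of_one_le_of_one_le (one_le_pow₀ hL) (one_le_pow₀ hH')
      nlinarith
    have := hlower T (by linarith)
    have := Int.lt_floor_add_one T
    linarith
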